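/- Let $F$ be a free subgroup of $\mathrm{SL}(2,\mathbb{Z})$ of rank at least $2$, acting on $\mathbb{Z}^2$ by matrix multiplication. Then the semidirect product $F \ltimes \mathbb{Z}^2$ is locally indicable (that is, each of its nontrivial finitely generated subgroups admits a surjective homomorphism onto $\mathbb{Z}$), but it does not embed into the group $\mathrm{Diff}^1_+(]0,1[)$ of orientation-preserving $C^1$ diffeomorphisms of the open interval $]0,1[$; that is, it admits no faithful action on $]0,1[$ by such diffeomorphisms. Consequently, local indicability does not suffice for embedding into $\mathrm{Diff}^1_+$ of the interval, even for finitely generated groups: there is a finitely generated, locally indicable group that embeds into none of $\mathrm{Diff}^1_+(]0,1[)$, $\mathrm{Diff}^1_+([0,1[)$ and $\mathrm{Diff}^1_+([0,1])$. -/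

import Mathlib

open scoped MatrixGroups

/-- A group is locally indicable if each of its nontrivial finitely generated subgroups
surjects onto `ℤ`. -/
def LocallyIndicable (G : Type*) [Group G] : Prop :=
  ∀ K : Subgroup G, K.FG → K ≠ ⊥ →
    ∃ f : K →* Multiplicative ℤ, Function.Surjective f

/-- A self-map of an interval `I ⊆ ℝ` is of class `C¹` on `I` (with one-sided derivatives at the
endpoints that belong to `I`). -/
def IsC1On (I : Set ℝ) (f : I → I) : Prop :=
  ∃ g : ℝ → ℝ, ContDiffOn ℝ 1 g I ∧ ∀ x : I, g x = (f x : ℝ)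

theorem IsC1On.comp {I : Set ℝ} {f g : I → I} (hf : IsC1On I f) (hg : IsC1On I g) :
    IsC1On I (f ∘ g) := by
  obtain ⟨f', hf', hf⟩ := hf
  obtain ⟨g', hg', hg⟩ := hg
  refine ⟨f' ∘ g', hf'.comp hg' ?_, ?_⟩
  · intro x hx
    have h := hg ⟨x, hx⟩
    simp only at h
    rw [h]
    exact (g ⟨x, hx⟩).2
  · intro x
    simp [hg, hf]

theorem IsC1On.id (I : Set ℝ) : IsC1On I _root_.id :=
  ⟨_root_.id, contDiffOn_id, fun _ => rfl⟩

/-- `Diff¹₊(I)`: the group, under composition, of the orientation-preserving `C¹` diffeomorphisms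
of an interval `I ⊆ ℝ`, that is, of the increasing bijections of `I` that are of class `C¹`
together with their inverses. -/
def DiffPlus (I : Set ℝ) : Subgroup (Equiv.Perm I) where
  carrier := {f | StrictMono f ∧ IsC1On I f ∧ IsC1On I f.symm}
  one_mem' := ⟨strictMono_id, IsC1On.id I, IsC1On.id I⟩
  mul_mem' := by
    rintro f g ⟨hf, hf', hf''⟩ ⟨hg, hg', hg''⟩
    exact ⟨hf.comp hg, hf'.comp hg', hg''.comp hf''⟩
  inv_mem' := by
    rintro f ⟨hf, hf', hf''⟩
    refine ⟨?_, hf'', hf'⟩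
    intro x y hxy
    have h : f (f⁻¹ x) < f (f⁻¹ y) := by simpa using hxy
    exact hf.lt_iff_lt.mp h

/-- The group `G` embeds into `Diff¹₊(I)`: it has a faithful action on `I` by
orientation-preserving `C¹` diffeomorphisms. -/
def EmbedsInDiffPlus (G : Type*) [Group G] (I : Set ℝ) : Prop :=
  ∃ ρ : G →* DiffPlus I, Function.Injective ρ

/-- The linear action `v ↦ A v` of a subgroup `F` of `SL(2,ℤ)` on (column vectors of) `ℤ²`,
by group automorphisms. The group `ℤ²` is written multiplicatively. -/
def linearAction (F : Subgroup SL(2, ℤ)) : F →* MulAut (Multiplicative (Fin 2 → ℤ)) where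
  toFun A :=
    { toFun := fun v => .ofAdd
        (((A : SL(2, ℤ)) : Matrix (Fin 2) (Fin 2) ℤ).mulVec v.toAdd)
      invFun := fun v => .ofAdd
        ((((A : SL(2, ℤ))⁻¹ : SL(2, ℤ)) : Matrix (Fin 2) (Fin 2) ℤ).mulVec v.toAdd)
      left_inv := fun v => by
        beta_reduce
        rw [toAdd_ofAdd, Matrix.mulVec_mulVec, ← Matrix.SpecialLinearGroup.coe_mul,
          inv_mul_cancel, Matrix.SpecialLinearGroup.coe_one, Matrix.one_mulVec, ofAdd_toAdd]
      right_inv := fun v => by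
        beta_reduce
        rw [toAdd_ofAdd, Matrix.mulVec_mulVec, ← Matrix.SpecialLinearGroup.coe_mul,
          mul_inv_cancel, Matrix.SpecialLinearGroup.coe_one, Matrix.one_mulVec, ofAdd_toAdd]
      map_mul' := fun v w => by
        rw [toAdd_mul, Matrix.mulVec_add, ofAdd_add] }
  map_one' := by
    refine MulEquiv.ext fun v => congrArg Multiplicative.ofAdd ?_
    exact Matrix.one_mulVec v.toAdd
  map_mul' A B := by
    refine MulEquiv.ext fun v => congrArg Multiplicative.ofAdd ?_
    exact (Matrix.mulVec_mulVec v.toAdd _ _).symm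

/-- The semidirect product `F ⋉ ℤ²` of a subgroup `F` of `SL(2,ℤ)` with `ℤ²`, for the action by
matrix multiplication. -/
abbrev LinearSemidirect (F : Subgroup SL(2, ℤ)) : Type :=
  SemidirectProduct (Multiplicative (Fin 2 → ℤ)) F (linearAction F)

/-!
Let `F` be a free subgroup of `SL(2, ℤ)` of rank at least two. Local indicability of `F ⋉ ℤ²` is
formal: a nontrivial subgroup either has a nontrivial image in `F`, which is free by
Nielsen-Schreier, or is contained in `ℤ²`; in both cases it maps nontrivially to `ℤ`.

Suppose now that `F ⋉ ℤ²` acts faithfully on `]0, 1[` by `C¹` diffeomorphisms. Consider the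
components of the complement of the global fixed points of `ℤ²`; they are permuted by `F`. On a
component `J`, translation numbers turn the action of `ℤ²` into a linear form, that is, into a
direction `u` in the plane (`IsComponent.exists_isDirection`), unique up to positive scaling, and
the direction of `f J` is `f u`. The group `F` contains two non-commuting hyperbolic matrices
(`exists_hyperbolic_pair`), which have no common eigenline by integrality, so that large powers of
them and of their inverses play ping-pong on directions (`exists_expanding_cones`): each expands
all directions outside a small cone, and these four cones are disjoint.

Hence every component can be moved, to the left as well as to the right, by one of these four maps
that expands its direction. This gives an infinite walk of components, all in a compact subset of
`]0, 1[` (`exists_isExpandingWalk`). The walk never returns to a component, because the cone that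
contains a direction determines the last step. The components of the walk are thus disjoint, and
their lengths tend to `0`.

On short intervals `C¹` maps are almost affine. An element of `ℤ²` fixes the end points of each
component, so its derivative on a short one is close to `1`. Therefore the displacement vector of a
point under the two generators of `ℤ²` points asymptotically in the direction of its component, and
under a step of the walk it transforms like the direction, up to the derivative of the step. The
length of the component is multiplied by almost the same derivative, so the quotient of
displacement and length at least doubles with each step. But it is at most `1`, which is absurd
(`IsExpandingWalk.elim`).

For the half-open and the closed interval, restrict the action to `]0, 1[`. A free subgroup of rank
two is provided by ping-pong on the upper half-plane.
-/

/-! ### Local indicability -/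

/-- The image of a nontrivial homomorphism to `ℤ` is infinite cyclic, so that it can be divided by a
generator of this image. -/
theorem exists_surjective_hom_of_ne_one {K : Type*} [Group K] (f : K →* Multiplicative ℤ)
    (hf : f ≠ 1) : ∃ g : K →* Multiplicative ℤ, Function.Surjective g := by
  obtain ⟨n, hn⟩ := Int.subgroup_cyclic (AddSubgroup.toSubgroup.symm f.range)
  have hmem : ∀ k : K, ∃ m : ℤ, m * n = (f k).toAdd := by
    intro k
    have : (f k).toAdd ∈ AddSubgroup.toSubgroup.symm f.range := ⟨k, rfl⟩
    rw [hn, AddSubgroup.mem_closure_singleton] at this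
    simpa using this
  have hn0 : n ≠ 0 := by
    rintro rfl
    refine hf (MonoidHom.ext fun k => ?_)
    obtain ⟨m, hm⟩ := hmem k
    simpa using hm.symm
  choose g hg using hmem
  refine ⟨{ toFun := fun k => .ofAdd (g k), map_one' := ?_, map_mul' := ?_ }, ?_⟩
  · have := hg 1
    simpa [hn0] using this
  · intro x y
    have := hg (x * y)
    rw [map_mul, toAdd_mul, ← hg x, ← hg y, ← add_mul] at this
    exact congrArg _ (mul_right_cancel₀ hn0 this)
  · intro m
    have : n ∈ AddSubgroup.toSubgroup.symm f.range := hn ▸ AddSubgroup.mem_closure_of_mem rfl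
    obtain ⟨k, hk⟩ := this
    refine ⟨k ^ m.toAdd, ?_⟩
    have h1 := hg (k ^ m.toAdd)
    have hk' : (f k).toAdd = n := congrArg Multiplicative.toAdd hk
    rw [map_zpow, toAdd_zpow, hk', smul_eq_mul] at h1
    exact congrArg Multiplicative.ofAdd (mul_right_cancel₀ hn0 h1)

theorem exists_hom_ne_one_of_isFreeGroup {H : Type*} [Group H] [IsFreeGroup H] [Nontrivial H] :
    ∃ f : H →* Multiplicative ℤ, f ≠ 1 := by
  have b := IsFreeGroup.basis H
  by_cases hι : IsEmpty (IsFreeGroup.Generators H)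
  · exact absurd (b.repr.toEquiv.subsingleton) (not_subsingleton H)
  · obtain ⟨i⟩ := not_isEmpty_iff.mp hι
    refine ⟨b.lift fun _ => .ofAdd 1, fun h => ?_⟩
    have := congrArg (fun f => f (b i)) h
    simp at this

/-- A semidirect product of `ℤ²` with a free group is locally indicable: a nontrivial subgroup
either has a nontrivial, hence free, image in the free factor, or lies in `ℤ²`. -/
theorem locallyIndicable_linearSemidirect (F : Subgroup SL(2, ℤ)) [IsFreeGroup F] :
    LocallyIndicable (LinearSemidirect F) := by
  intro K _ hK
  let π : K →* F := SemidirectProduct.rightHom.comp K.subtype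
  by_cases hπ : π.range = ⊥
  · obtain ⟨k, hk⟩ := Subgroup.ne_bot_iff_exists_ne_one.mp hK
    have hright : ∀ x : K, (x : LinearSemidirect F).right = 1 := fun x => by
      have : π x ∈ π.range := ⟨x, rfl⟩
      rwa [hπ, Subgroup.mem_bot] at this
    let left : K →* Multiplicative (Fin 2 → ℤ) :=
      { toFun := fun x => (x : LinearSemidirect F).left
        map_one' := rfl
        map_mul' := fun x y => by
          simp [SemidirectProduct.mul_left, hright x] }
    have hleft : left k ≠ 1 := fun h => hk (Subtype.ext (SemidirectProduct.ext h (hright k)))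
    obtain ⟨i, hi⟩ : ∃ i, (left k).toAdd i ≠ 0 := by
      by_contra! h
      exact hleft (congrArg Multiplicative.ofAdd (funext h))
    refine exists_surjective_hom_of_ne_one
      ((AddMonoidHom.toMultiplicative (Pi.evalAddMonoidHom (fun _ : Fin 2 => ℤ) i)).comp left) ?_
    intro h
    exact hi (congrArg (fun f => (f k).toAdd) h)
  · have : Nontrivial π.range := (Subgroup.nontrivial_iff_ne_bot _).mpr hπ
    obtain ⟨f, hf⟩ := exists_hom_ne_one_of_isFreeGroup (H := π.range)
    refine exists_surjective_hom_of_ne_one (f.comp π.rangeRestrict) fun h => hf ?_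
    rw [← MonoidHom.one_comp π.rangeRestrict] at h
    exact (MonoidHom.cancel_right π.rangeRestrict_surjective).mp h

theorem fg_linearSemidirect (F : Subgroup SL(2, ℤ)) [Group.FG F] :
    Group.FG (LinearSemidirect F) := by
  rw [Group.fg_def]
  have h : (⊤ : Subgroup (LinearSemidirect F)) =
      (SemidirectProduct.inl : _ →* LinearSemidirect F).range ⊔
      (SemidirectProduct.inr : _ →* LinearSemidirect F).range := by
    refine (top_le_iff.mp fun x _ => ?_).symm
    rw [← SemidirectProduct.inl_left_mul_inr_right x]
    exact mul_mem (Subgroup.mem_sup_left ⟨_, rfl⟩) (Subgroup.mem_sup_right ⟨_, rfl⟩)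
  rw [h]
  exact ((Group.fg_iff_subgroup_fg _).mp inferInstance).sup
    ((Group.fg_iff_subgroup_fg _).mp inferInstance)

/-! ### A free subgroup of rank two -/

/-- The two unipotent matrices `(1 2; 0 1)` and `(1 0; 2 1)`. -/
def sanovGenerator : Bool → SL(2, ℤ)
  | true => ⟨!![1, 2; 0, 1], by simp [Matrix.det_fin_two]⟩
  | false => ⟨!![1, 0; 2, 1], by simp [Matrix.det_fin_two]⟩

open UpperHalfPlane in
/-- Ping-pong on the upper half-plane: the first generator is the translation by `2`, and the
second one becomes the translation by `-2` in the coordinate `-1 / z`. -/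
theorem injective_lift_sanovGenerator :
    Function.Injective (FreeGroup.lift sanovGenerator) := by
  have hA : ∀ z : ℍ, (sanovGenerator true • z).re = z.re + 2 := fun z => by
    rw [← coe_re, coe_specialLinearGroup_apply]
    simp [sanovGenerator]
  have hA' : ∀ z : ℍ, ((sanovGenerator true)⁻¹ • z).re = z.re - 2 := fun z => by
    have := hA ((sanovGenerator true)⁻¹ • z)
    rw [smul_inv_smul] at this
    linarith
  -- The real part of the coordinate `-1 / z`.
  let w : ℍ → ℝ := fun z => (-1 / (z : ℂ)).re
  have hB : ∀ z : ℍ, w (sanovGenerator false • z) = w z - 2 := fun z => by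
    have hz := z.ne_zero
    have hz' : 2 * (z : ℂ) + 1 ≠ 0 := by
      intro h
      have := congrArg Complex.im h
      simp [z.im_ne_zero] at this
    simp only [w]
    rw [coe_specialLinearGroup_apply]
    have : (-1 / (((algebraMap ℤ ℝ (sanovGenerator false 0 0) : ℂ) * z +
        (algebraMap ℤ ℝ (sanovGenerator false 0 1) : ℂ)) /
        ((algebraMap ℤ ℝ (sanovGenerator false 1 0) : ℂ) * z +
        (algebraMap ℤ ℝ (sanovGenerator false 1 1) : ℂ)))) = -1 / (z : ℂ) - 2 := by
      simp [sanovGenerator]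
      field_simp
      ring
    rw [this]
    simp
  have hB' : ∀ z : ℍ, w ((sanovGenerator false)⁻¹ • z) = w z + 2 := fun z => by
    have := hB ((sanovGenerator false)⁻¹ • z)
    rw [smul_inv_smul] at this
    linarith
  have hw : ∀ z : ℍ, w z * (z.re ^ 2 + z.im ^ 2) = - z.re := fun z => by
    have h0 : z.re ^ 2 + z.im ^ 2 ≠ 0 := by have := z.im_pos; positivity
    simp only [w, Complex.div_re, Complex.normSq_apply, coe_re, coe_im, Complex.neg_re,
      Complex.one_re, Complex.neg_im, Complex.one_im]
    rw [← pow_two, ← pow_two]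
    field_simp
    ring
  -- The half-planes used by the two generators are disjoint.
  have key : ∀ z : ℍ, 1 ≤ |z.re| → |w z| < 1 := fun z hz => by
    have h := congrArg abs (hw z)
    have h0 : 0 < z.im ^ 2 := by have := z.im_pos; positivity
    have h1 := sq_abs z.re
    rw [abs_neg, abs_mul, abs_of_pos (by positivity : 0 < z.re ^ 2 + z.im ^ 2), ← h1] at h
    by_contra! hw1
    nlinarith [abs_nonneg z.re]
  let X : Bool → Set ℍ := fun i => cond i {z | 1 ≤ z.re} {z | w z ≤ -1}
  let Y : Bool → Set ℍ := fun i => cond i {z | z.re < -1} {z | 1 < w z}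
  have hX1 : ∀ z : ℍ, 1 ≤ z.re → 1 ≤ |z.re| := fun z hz => hz.trans (le_abs_self _)
  have hY1 : ∀ z : ℍ, z.re < -1 → 1 ≤ |z.re| := fun z hz => by
    rw [abs_of_neg (by linarith)]; linarith
  refine FreeGroup.injective_lift_of_ping_pong sanovGenerator X Y ?_ ?_ ?_ ?_ ?_ ?_
  · rintro (_ | _)
    · refine ⟨⟨⟨1 / 2, 1 / 2⟩, by norm_num⟩, ?_⟩
      simp only [X, w, cond_false, Set.mem_ofPred_eq, Complex.div_re, Complex.normSq_apply]
      norm_num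
    · exact ⟨⟨⟨1, 1⟩, by norm_num⟩, le_refl (1 : ℝ)⟩
  · rintro (_ | _) (_ | _) hij <;> first | exact absurd rfl hij | skip
    · exact Set.disjoint_left.mpr fun z (h1 : w z ≤ -1) (h2 : 1 ≤ z.re) => by
        linarith [abs_lt.mp (key z (hX1 z h2))]
    · exact Set.disjoint_left.mpr fun z (h2 : 1 ≤ z.re) (h1 : w z ≤ -1) => by
        linarith [abs_lt.mp (key z (hX1 z h2))]
  · rintro (_ | _) (_ | _) hij <;> first | exact absurd rfl hij | skip
    · exact Set.disjoint_left.mpr fun z (h1 : 1 < w z) (h2 : z.re < -1) => by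
        linarith [abs_lt.mp (key z (hY1 z h2))]
    · exact Set.disjoint_left.mpr fun z (h2 : z.re < -1) (h1 : 1 < w z) => by
        linarith [abs_lt.mp (key z (hY1 z h2))]
  · rintro (_ | _) (_ | _)
    · exact Set.disjoint_left.mpr fun z (h1 : w z ≤ -1) (h2 : 1 < w z) => by linarith
    · exact Set.disjoint_left.mpr fun z (h1 : w z ≤ -1) (h2 : z.re < -1) => by
        linarith [abs_lt.mp (key z (hY1 z h2))]
    · exact Set.disjoint_left.mpr fun z (h2 : 1 ≤ z.re) (h1 : 1 < w z) => by
        linarith [abs_lt.mp (key z (hX1 z h2))]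
    · exact Set.disjoint_left.mpr fun z (h1 : 1 ≤ z.re) (h2 : z.re < -1) => by linarith
  · rintro (_ | _) _ ⟨z, hz, rfl⟩
    · have hz : ¬ 1 < w z := hz
      change w (sanovGenerator false • z) ≤ -1
      rw [hB]; linarith
    · have hz : ¬ z.re < -1 := hz
      change 1 ≤ (sanovGenerator true • z).re
      rw [hA]; linarith
  · rintro (_ | _) _ ⟨z, hz, rfl⟩
    · have hz : ¬ w z ≤ -1 := hz
      change 1 < w ((sanovGenerator false)⁻¹ • z)
      rw [hB']; linarith
    · have hz : ¬ 1 ≤ z.re := hz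
      change ((sanovGenerator true)⁻¹ • z).re < -1
      rw [hA']; linarith

/-- The group `SL(2, ℤ)` has a free subgroup of rank two. -/
theorem exists_free_subgroup_rank_two :
    ∃ F : Subgroup SL(2, ℤ), Group.FG F ∧ Nonempty (FreeGroupBasis Bool F) :=
  ⟨(FreeGroup.lift sanovGenerator).range, inferInstance,
    ⟨(FreeGroupBasis.ofFreeGroup Bool).map
      (MonoidHom.ofInjective injective_lift_sanovGenerator)⟩⟩

/-! ### Extension of actions by the identity -/

/-- A homomorphism to the permutations of `ℝ` is a `C¹` action on `]0,1[` if every element acts by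
an increasing map, `C¹` on `]0,1[` and fixing all other points. Extending by the identity keeps the
end points available as global fixed points. -/
structure IsC1Action {G : Type*} [Group G] (φ : G →* Equiv.Perm ℝ) : Prop where
  strictMono : ∀ g, StrictMono (φ g)
  apply_eq_self : ∀ g, ∀ x ∉ Set.Ioo (0 : ℝ) 1, φ g x = x
  contDiffOn : ∀ g, ContDiffOn ℝ 1 (φ g) (Set.Ioo 0 1)

/-- An embedding into `Diff¹₊(I)`, for an interval `I` with end points `0` and `1`, restricts
faithfully to `]0,1[`, because increasing bijections of `I` fix the end points that lie in `I`. -/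
theorem EmbedsInDiffPlus.exists_isC1Action {G : Type*} [Group G] {I : Set ℝ} [I.OrdConnected]
    (hI : Set.Ioo 0 1 ⊆ I) (hI' : I ⊆ Set.Icc 0 1) (h : EmbedsInDiffPlus G I) :
    ∃ φ : G →* Equiv.Perm ℝ, Function.Injective φ ∧ IsC1Action φ := by
  classical
  obtain ⟨ρ, hρ⟩ := h
  let φ : G →* Equiv.Perm ℝ :=
    (Equiv.Perm.ofSubtype (p := (· ∈ I))).comp ((DiffPlus I).subtype.comp ρ)
  have hφ : ∀ g (x : I), φ g x = ((ρ g : Equiv.Perm I) x : ℝ) := fun g x =>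
    Equiv.Perm.ofSubtype_apply_coe _ x
  have hφ' : ∀ g, ∀ x ∉ I, φ g x = x := fun g x hx => Equiv.Perm.ofSubtype_apply_of_not_mem _ hx
  have hmono : ∀ g, StrictMono (φ g) := by
    intro g x y hxy
    by_cases hx : x ∈ I <;> by_cases hy : y ∈ I
    · rw [hφ g ⟨x, hx⟩, hφ g ⟨y, hy⟩]
      exact (ρ g).2.1 (show (⟨x, hx⟩ : I) < ⟨y, hy⟩ from hxy)
    · rw [hφ g ⟨x, hx⟩, hφ' g y hy]
      by_contra! hle
      exact hy (Set.OrdConnected.out ‹_› hx ((ρ g : Equiv.Perm I) ⟨x, hx⟩).2 ⟨hxy.le, hle⟩)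
    · rw [hφ' g x hx, hφ g ⟨y, hy⟩]
      by_contra! hle
      exact hx (Set.OrdConnected.out ‹_› ((ρ g : Equiv.Perm I) ⟨y, hy⟩).2 hy ⟨hle, hxy.le⟩)
    · rwa [hφ' g x hx, hφ' g y hy]
  refine ⟨φ, Equiv.Perm.ofSubtype_injective.comp (Subtype.val_injective.comp hρ), hmono, ?_, ?_⟩
  · intro g x hx
    by_cases hxI : x ∈ I
    · have hmem : ∀ g, φ g x ∈ I := fun g => by rw [hφ g ⟨x, hxI⟩]; exact Subtype.coe_prop _
      have hinv : φ g (φ g⁻¹ x) = x := by rw [← Equiv.Perm.mul_apply, ← map_mul]; simp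
      have hx01 : x = 0 ∨ x = 1 := by
        obtain ⟨h0, h1⟩ := hI' hxI
        by_contra! hne
        exact hx ⟨lt_of_le_of_ne h0 hne.1.symm, lt_of_le_of_ne h1 hne.2⟩
      rcases hx01 with rfl | rfl
      · refine le_antisymm ?_ (hI' (hmem g)).1
        calc φ g 0 ≤ φ g (φ g⁻¹ 0) := (hmono g).monotone (hI' (hmem g⁻¹)).1
          _ = 0 := hinv
      · refine le_antisymm (hI' (hmem g)).2 ?_
        calc 1 = φ g (φ g⁻¹ 1) := hinv.symm
          _ ≤ φ g 1 := (hmono g).monotone (hI' (hmem g⁻¹)).2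
    · exact hφ' g x hxI
  · intro g
    obtain ⟨f, hf, hfg⟩ := (ρ g).2.2.1
    exact (hf.mono hI).congr fun x hx => by rw [hφ g ⟨x, hI hx⟩, ← hfg ⟨x, hI hx⟩]

/-! ### Linear action on the plane -/

/-- The linear action of `SL(2, ℤ)` on the real plane. -/
def realAction : SL(2, ℤ) →* Module.End ℝ (Fin 2 → ℝ) where
  toFun M := ((M : Matrix (Fin 2) (Fin 2) ℤ).map (Int.castRingHom ℝ)).mulVecLin
  map_one' := by simp [Matrix.map_one]; rfl
  map_mul' M N := by
    rw [Matrix.SpecialLinearGroup.coe_mul, Matrix.map_mul, Matrix.mulVecLin_mul]; rfl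

theorem realAction_apply_zero (M : SL(2, ℤ)) (u : Fin 2 → ℝ) :
    realAction M u 0 = M 0 0 * u 0 + M 0 1 * u 1 := by
  simp [realAction, Matrix.mulVec, dotProduct, Fin.sum_univ_two]

theorem realAction_apply_one (M : SL(2, ℤ)) (u : Fin 2 → ℝ) :
    realAction M u 1 = M 1 0 * u 0 + M 1 1 * u 1 := by
  simp [realAction, Matrix.mulVec, dotProduct, Fin.sum_univ_two]

theorem realAction_ne_zero (M : SL(2, ℤ)) {u : Fin 2 → ℝ} (hu : u ≠ 0) : realAction M u ≠ 0 := by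
  intro h
  apply hu
  have : realAction M⁻¹ (realAction M u) = 0 := by rw [h, map_zero]
  rwa [← Module.End.mul_apply, ← map_mul, inv_mul_cancel, map_one] at this

/-- The area form, evaluated on a real and an integral vector. It serves to encode linear forms on
`ℤ²` by vectors in such a way that `SL(2, ℤ)` acts on both by the same matrices. -/
def cross (u : Fin 2 → ℝ) (v : Fin 2 → ℤ) : ℝ := u 0 * v 1 - u 1 * v 0

theorem det_eq (M : SL(2, ℤ)) : M 0 0 * M 1 1 - M 0 1 * M 1 0 = 1 := by
  rw [← Matrix.det_fin_two]; exact M.2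

theorem det_eq_real (M : SL(2, ℤ)) :
    (M 0 0 : ℝ) * M 1 1 - (M 0 1 : ℝ) * M 1 0 = 1 := by exact_mod_cast det_eq M

/-- Invariance of the area form. -/
theorem cross_realAction (M : SL(2, ℤ)) (u : Fin 2 → ℝ) (v : Fin 2 → ℤ) :
    cross (realAction M u) ((M : Matrix (Fin 2) (Fin 2) ℤ).mulVec v) = cross u v := by
  have h := det_eq_real M
  simp only [cross, realAction_apply_zero, realAction_apply_one, Matrix.mulVec, dotProduct,
    Fin.sum_univ_two]
  push_cast
  linear_combination (u 0 * v 1 - u 1 * v 0) * h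

theorem cross_add (u : Fin 2 → ℝ) (v w : Fin 2 → ℤ) :
    cross u (v + w) = cross u v + cross u w := by
  simp only [cross, Pi.add_apply]; push_cast; ring

theorem cross_neg (u : Fin 2 → ℝ) (v : Fin 2 → ℤ) : cross u (-v) = - cross u v := by
  simp only [cross, Pi.neg_apply]; push_cast; ring

theorem cross_smul (c : ℝ) (u : Fin 2 → ℝ) (v : Fin 2 → ℤ) :
    cross (c • u) v = c * cross u v := by
  simp only [cross, Pi.smul_apply, smul_eq_mul]; ring

theorem exists_smul_eq_of_det_eq_zero {u w : Fin 2 → ℝ} (hu : u ≠ 0)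
    (h : u 0 * w 1 - u 1 * w 0 = 0) : ∃ c : ℝ, w = c • u := by
  by_cases h0 : u 0 = 0
  · have h1 : u 1 ≠ 0 := fun h1 => hu (by ext i; fin_cases i <;> simp [h0, h1])
    refine ⟨w 1 / u 1, ?_⟩
    have : w 0 = 0 := by simpa [h0, h1] using h
    ext i; fin_cases i
    · simp [h0, this]
    · simp [h1]
  · refine ⟨w 0 / u 0, ?_⟩
    ext i; fin_cases i
    · simp [h0]
    · simp; field_simp; linarith

theorem fin_two_ne_zero {R : Type*} [Zero R] {v : Fin 2 → R} (hv : v ≠ 0) : v 0 ≠ 0 ∨ v 1 ≠ 0 := by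
  by_contra! h
  exact hv (by ext i; fin_cases i <;> simp [h])

theorem charpoly_eq_zero_of_eigenvector {M : SL(2, ℤ)} {u : Fin 2 → ℝ} {c : ℝ} (hu : u ≠ 0)
    (h : realAction M u = c • u) : c ^ 2 - (M 0 0 + M 1 1) * c + 1 = 0 := by
  have h0 := congrFun h 0
  have h1 := congrFun h 1
  rw [realAction_apply_zero, Pi.smul_apply, smul_eq_mul] at h0
  rw [realAction_apply_one, Pi.smul_apply, smul_eq_mul] at h1
  have hd := det_eq_real M
  rcases fin_two_ne_zero hu with h | h
  · apply mul_right_cancel₀ h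
    linear_combination (M 1 1 - c) * h0 - M 0 1 * h1 - u 0 * hd
  · apply mul_right_cancel₀ h
    linear_combination (M 0 0 - c) * h1 - M 1 0 * h0 - u 1 * hd

/-- An integral hyperbolic matrix has no eigenvector of rational slope, because `t² - 4` is not a
square for `|t| ≥ 3`. -/
theorem cross_ne_zero_of_eigenvector {M : SL(2, ℤ)} (hM : 3 ≤ |M 0 0 + M 1 1|) {u : Fin 2 → ℝ}
    {c : ℝ} (hu : u ≠ 0) (h : realAction M u = c • u) {v : Fin 2 → ℤ} (hv : v ≠ 0) :
    cross u v ≠ 0 := by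
  intro hc
  set t := M 0 0 + M 1 1 with ht
  -- The integral vector `v` is then an eigenvector itself, and the eigenvalue is rational.
  obtain ⟨d, hd⟩ := exists_smul_eq_of_det_eq_zero (w := fun i => (v i : ℝ)) hu hc
  have hvc : realAction M (fun i => (v i : ℝ)) = c • (fun i => (v i : ℝ)) := by
    rw [hd, map_smul, h, smul_comm]
  have hchar := charpoly_eq_zero_of_eigenvector hu h
  obtain ⟨i, hi, K, hK⟩ : ∃ i, v i ≠ 0 ∧ ∃ K : ℤ, (K : ℝ) = c * v i := by
    rcases fin_two_ne_zero hv with h' | h'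
    · refine ⟨0, h', M 0 0 * v 0 + M 0 1 * v 1, ?_⟩
      have := congrFun hvc 0
      rw [realAction_apply_zero] at this
      push_cast; simpa using this
    · refine ⟨1, h', M 1 0 * v 0 + M 1 1 * v 1, ?_⟩
      have := congrFun hvc 1
      rw [realAction_apply_one] at this
      push_cast; simpa using this
  have hsq : (2 * K - t * v i) ^ 2 = (t ^ 2 - 4) * v i ^ 2 := by
    have : ((2 * K - t * v i) ^ 2 : ℝ) = (t ^ 2 - 4) * v i ^ 2 := by
      rw [hK, ht]; push_cast
      linear_combination 4 * (v i : ℝ) ^ 2 * hchar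
    exact_mod_cast this
  obtain ⟨j, hj⟩ : v i ∣ 2 * K - t * v i :=
    (Int.pow_dvd_pow_iff two_ne_zero).mp ⟨t ^ 2 - 4, by rw [hsq]; ring⟩
  have hj2 : j ^ 2 = t ^ 2 - 4 := by
    rw [hj] at hsq
    apply mul_right_cancel₀ (pow_ne_zero 2 hi)
    linarith
  have hlt : |j| < |t| := sq_lt_sq.mp (by linarith)
  rw [← sq_abs j, ← sq_abs t] at hj2
  nlinarith [abs_nonneg j]

/-- The fixed line of a matrix `M ≠ 1` is the kernel of an integral matrix, hence rational. -/
theorem exists_cross_eq_zero_of_fixed {M : SL(2, ℤ)} (hM : M ≠ 1) {u : Fin 2 → ℝ}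
    (h : realAction M u = u) : ∃ v : Fin 2 → ℤ, v ≠ 0 ∧ cross u v = 0 := by
  have h0 := congrFun h 0
  have h1 := congrFun h 1
  rw [realAction_apply_zero] at h0
  rw [realAction_apply_one] at h1
  by_contra! hne
  have e0 : (![-(M 0 1), M 0 0 - 1] : Fin 2 → ℤ) = 0 := by
    by_contra hv
    refine hne _ hv ?_
    simp only [cross, Matrix.cons_val_zero, Matrix.cons_val_one]
    push_cast; linarith
  have e1 : (![-(M 1 1 - 1), M 1 0] : Fin 2 → ℤ) = 0 := by
    by_contra hv
    refine hne _ hv ?_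
    simp only [cross, Matrix.cons_val_zero, Matrix.cons_val_one]
    push_cast; linarith
  apply hM
  have a0 := congrFun e0 0
  have a1 := congrFun e0 1
  have b0 := congrFun e1 0
  have b1 := congrFun e1 1
  simp at a0 a1 b0 b1
  ext i j
  fin_cases i <;> fin_cases j <;> simp <;> omega

/-- A hyperbolic matrix and a matrix not commuting with it have no common eigenvector: the
commutator would fix it, so that it would have rational slope. -/
theorem no_common_eigenvector {a b : SL(2, ℤ)} (ha : 3 ≤ |a 0 0 + a 1 1|) (hab : a * b ≠ b * a)
    {u : Fin 2 → ℝ} {c d : ℝ} (hu : u ≠ 0) (h : realAction a u = c • u)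
    (h' : realAction b u = d • u) : False := by
  have hd : d ≠ 0 := by
    rintro rfl
    exact realAction_ne_zero b hu (by simpa using h')
  have hc : c ≠ 0 := by
    rintro rfl
    exact realAction_ne_zero a hu (by simpa using h)
  have hinv : ∀ {g : SL(2, ℤ)} {e : ℝ}, e ≠ 0 → realAction g u = e • u →
      realAction g⁻¹ u = e⁻¹ • u := by
    intro g e he hg
    have := congrArg (realAction g⁻¹) hg
    rw [map_smul, ← Module.End.mul_apply, ← map_mul, inv_mul_cancel, map_one] at this
    rw [eq_inv_smul_iff₀ he, ← this]; rfl
  have hfix : realAction (a * b * a⁻¹ * b⁻¹) u = u := by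
    simp only [map_mul, Module.End.mul_apply, hinv hd h', hinv hc h, map_smul, h, h', smul_smul]
    rw [show d⁻¹ * (c⁻¹ * (d * c)) = 1 by field_simp, one_smul]
  obtain ⟨v, hv, hv'⟩ := exists_cross_eq_zero_of_fixed
    (fun h1 => hab (by simpa [mul_inv_eq_one, mul_inv_eq_iff_eq_mul] using h1)) hfix
  exact cross_ne_zero_of_eigenvector ha hu h hv hv'

/-- The kernel of an eigenfunctional is an eigenline. -/
theorem eigenvector_of_functional {M : SL(2, ℤ)} {l : (Fin 2 → ℝ) →ₗ[ℝ] ℝ} {c : ℝ} (hl : l ≠ 0)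
    (h : ∀ u, l (realAction M u) = c * l u) {u : Fin 2 → ℝ} (hu : u ≠ 0) (hlu : l u = 0) :
    ∃ d : ℝ, realAction M u = d • u := by
  have hcoord : ∀ w : Fin 2 → ℝ, l w = l (Pi.single 0 1) * w 0 + l (Pi.single 1 1) * w 1 := by
    intro w
    conv_lhs => rw [← Finset.univ_sum_single w, Fin.sum_univ_two]
    have : ∀ i, l (Pi.single i (w i)) = l (Pi.single i 1) * w i := fun i => by
      rw [show (Pi.single i (w i) : Fin 2 → ℝ) = w i • Pi.single i 1 by
        rw [← Pi.single_smul]; simp, map_smul, smul_eq_mul, mul_comm]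
    rw [map_add, this, this]
  refine exists_smul_eq_of_det_eq_zero hu ?_
  have h1 := h u
  rw [hlu, mul_zero] at h1
  set w := realAction M u
  rw [hcoord] at hlu h1
  have : l (Pi.single 0 1) ≠ 0 ∨ l (Pi.single 1 1) ≠ 0 := by
    by_contra! h0
    exact hl (LinearMap.ext fun w => by rw [hcoord, h0.1, h0.2]; simp)
  rcases this with h0 | h0
  · apply mul_left_cancel₀ h0
    linear_combination w 1 * hlu - u 1 * h1
  · apply mul_left_cancel₀ h0
    linear_combination u 0 * h1 - w 0 * hlu

theorem exists_contracting_root {t : ℤ} (ht : 3 ≤ |t|) :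
    ∃ k : ℝ, k ≠ 0 ∧ |k| < 1 ∧ k ^ 2 - t * k + 1 = 0 := by
  wlog h : 0 ≤ t generalizing t
  · obtain ⟨k, h0, h1, h2⟩ := this (t := -t) (by rwa [abs_neg]) (by omega)
    exact ⟨-k, by simpa using h0, by simpa using h1, by push_cast at h2; linarith⟩
  rw [abs_of_nonneg h] at ht
  have ht' : (3 : ℝ) ≤ t := by exact_mod_cast ht
  have hs := Real.sq_sqrt (show (0 : ℝ) ≤ t ^ 2 - 4 by nlinarith)
  have hs0 := Real.sqrt_nonneg ((t : ℝ) ^ 2 - 4)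
  set s := √((t : ℝ) ^ 2 - 4)
  have hpos : 0 < t + s := by linarith
  refine ⟨2 / (t + s), by positivity, ?_, ?_⟩
  · rw [abs_of_pos (by positivity), div_lt_one hpos]; linarith
  · field_simp; nlinarith

/-- A hyperbolic matrix has two eigenfunctionals in general position, a contracted one and an
expanded one. -/
theorem exists_eigenfunctionals {M : SL(2, ℤ)} (hM : 3 ≤ |M 0 0 + M 1 1|) :
    ∃ k : ℝ, k ≠ 0 ∧ |k| < 1 ∧ ∃ l : Bool → (Fin 2 → ℝ) →ₗ[ℝ] ℝ, (∀ e, l e ≠ 0) ∧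
      (∀ u, l true (realAction M u) = k * l true u) ∧
      (∀ u, l false (realAction M u) = k⁻¹ * l false u) ∧
      ∀ u, l true u = 0 → l false u = 0 → u = 0 := by
  obtain ⟨k, hk0, hk1, hk⟩ := exists_contracting_root hM
  have hd := det_eq_real M
  have hdZ := det_eq M
  push_cast at hk
  have hk' : k⁻¹ ^ 2 - (M 0 0 + M 1 1) * k⁻¹ + 1 = 0 := by
    field_simp; linarith
  -- A triangular matrix in `SL(2, ℤ)` has trace `2` or `-2`.
  have hr : (M 1 0 : ℝ) ≠ 0 := by
    intro h
    have h : M 1 0 = 0 := by exact_mod_cast h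
    rw [h, mul_zero, sub_zero] at hdZ
    rcases Int.eq_one_or_neg_one_of_mul_eq_one' hdZ with h | h <;> rw [h.1, h.2] at hM <;>
      norm_num at hM
  let L : ℝ → (Fin 2 → ℝ) →ₗ[ℝ] ℝ := fun c =>
    (M 1 0 : ℝ) • LinearMap.proj 0 + (c - M 0 0) • LinearMap.proj 1
  have hL : ∀ c u, L c u = M 1 0 * u 0 + (c - M 0 0) * u 1 := fun c u => by simp [L]
  have hLM : ∀ c : ℝ, c ^ 2 - (M 0 0 + M 1 1) * c + 1 = 0 →
      ∀ u, L c (realAction M u) = c * L c u := by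
    intro c hc u
    rw [hL, hL, realAction_apply_zero, realAction_apply_one]
    linear_combination (-u 1) * hc - u 1 * hd
  have hL0 : ∀ c, L c ≠ 0 := fun c h => hr (by simpa [hL] using congrArg (· ![1, 0]) h)
  have hkk : k⁻¹ ≠ k := by
    intro h
    have h1 : k * k = 1 := by nth_rewrite 1 [← h]; exact inv_mul_cancel₀ hk0
    have h2 := abs_mul k k
    rw [h1, abs_one] at h2
    nlinarith [abs_nonneg k]
  refine ⟨k, hk0, hk1, fun e => cond e (L k) (L k⁻¹), ?_, hLM k hk, hLM _ hk', ?_⟩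
  · rintro (_ | _) <;> exact hL0 _
  · intro u (h1 : L k u = 0) (h2 : L k⁻¹ u = 0)
    rw [hL] at h1 h2
    have hu1 : u 1 = 0 := mul_left_cancel₀ (sub_ne_zero.mpr hkk) (by linear_combination h2 - h1)
    have hu0 : u 0 = 0 := mul_left_cancel₀ hr (by rw [hu1] at h1; linear_combination h1)
    ext i; fin_cases i <;> simp [hu0, hu1]

/-! ### Ping-pong on directions -/

/-- The symmetric set `{a, a⁻¹, b, b⁻¹}`, indexed by the choice of a letter and of a sign. -/
def letter (a b : SL(2, ℤ)) (s : Bool × Bool) : SL(2, ℤ) :=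
  cond s.2 (cond s.1 a b) (cond s.1 a b)⁻¹

/-- The index of the inverse letter. -/
def invLetter (s : Bool × Bool) : Bool × Bool := (s.1, !s.2)

theorem letter_invLetter (a b : SL(2, ℤ)) (s : Bool × Bool) :
    letter a b (invLetter s) = (letter a b s)⁻¹ := by
  rcases s with ⟨_ | _, _ | _⟩ <;> simp [letter, invLetter]

/-- For two non-commuting hyperbolic matrices, each of the four letters contracts a functional
which its inverse expands, and no two of these functionals have a common kernel. -/
theorem exists_letter_functionals {a b : SL(2, ℤ)} (ha : 3 ≤ |a 0 0 + a 1 1|)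
    (hb : 3 ≤ |b 0 0 + b 1 1|) (hab : a * b ≠ b * a) :
    ∃ (k : Bool × Bool → ℝ) (l : Bool × Bool → (Fin 2 → ℝ) →ₗ[ℝ] ℝ),
      (∀ s, k s ≠ 0 ∧ |k s| < 1) ∧
      (∀ s u, l s (realAction (letter a b s) u) = k s * l s u) ∧
      (∀ s u, l (invLetter s) (realAction (letter a b s) u) = (k s)⁻¹ * l (invLetter s) u) ∧
      ∀ s s', s ≠ s' → ∀ u, l s u = 0 → l s' u = 0 → u = 0 := by
  obtain ⟨k, hk0, hk1, l, hl, hl1, hl2, hl3⟩ := exists_eigenfunctionals ha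
  obtain ⟨k', hk0', hk1', l', hl', hl1', hl2', hl3'⟩ := exists_eigenfunctionals hb
  have hcancel : ∀ (M : SL(2, ℤ)) (u : Fin 2 → ℝ), realAction M (realAction M⁻¹ u) = u := by
    intro M u
    rw [← Module.End.mul_apply, ← map_mul, mul_inv_cancel, map_one]; rfl
  have hmix : ∀ (e e' : Bool) u, l e u = 0 → l' e' u = 0 → u = 0 := by
    intro e e' u h h'
    by_contra hu
    have h1 : ∃ c, ∀ u, l e (realAction a u) = c * l e u := by
      cases e
      exacts [⟨_, hl2⟩, ⟨_, hl1⟩]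
    have h2 : ∃ c, ∀ u, l' e' (realAction b u) = c * l' e' u := by
      cases e'
      exacts [⟨_, hl2'⟩, ⟨_, hl1'⟩]
    obtain ⟨c, hc⟩ := eigenvector_of_functional (hl e) h1.choose_spec hu h
    obtain ⟨d, hd⟩ := eigenvector_of_functional (hl' e') h2.choose_spec hu h'
    exact no_common_eigenvector ha hab hu hc hd
  refine ⟨fun s => cond s.1 k k', fun s => cond s.1 (l s.2) (l' s.2), ?_, ?_, ?_, ?_⟩
  · rintro ⟨_ | _, _⟩
    exacts [⟨hk0', hk1'⟩, ⟨hk0, hk1⟩]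
  · rintro ⟨_ | _, _ | _⟩ u
    · have := hl2' (realAction b⁻¹ u)
      rw [hcancel] at this
      simp [letter, this, hk0']
    · simp [letter, hl1']
    · have := hl2 (realAction a⁻¹ u)
      rw [hcancel] at this
      simp [letter, this, hk0]
    · simp [letter, hl1]
  · rintro ⟨_ | _, _ | _⟩ u
    · have := hl1' (realAction b⁻¹ u)
      rw [hcancel] at this
      simp [letter, invLetter, this, hk0']
    · simp [letter, invLetter, hl2']
    · have := hl1 (realAction a⁻¹ u)
      rw [hcancel] at this
      simp [letter, invLetter, this, hk0]
    · simp [letter, invLetter, hl2]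
  · rintro ⟨_ | _, _ | _⟩ ⟨_ | _, _ | _⟩ hs u h h' <;> first | exact absurd rfl hs | skip
    exacts [hl3' u h' h, hmix _ _ u h' h, hmix _ _ u h' h, hl3' u h h', hmix _ _ u h' h,
      hmix _ _ u h' h, hmix _ _ u h h', hmix _ _ u h h', hl3 u h' h, hmix _ _ u h h',
      hmix _ _ u h h', hl3 u h h']

/-- The open cone around the kernel of `l` of aperture `c`. -/
def cone (l : (Fin 2 → ℝ) →ₗ[ℝ] ℝ) (c : ℝ) : Set (Fin 2 → ℝ) := {u | |l u| < c * ‖u‖}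

theorem mem_cone {l : (Fin 2 → ℝ) →ₗ[ℝ] ℝ} {c : ℝ} {u : Fin 2 → ℝ} :
    u ∈ cone l c ↔ |l u| < c * ‖u‖ := Iff.rfl

theorem cone_mono {l : (Fin 2 → ℝ) →ₗ[ℝ] ℝ} {c d : ℝ} (h : c ≤ d) : cone l c ⊆ cone l d :=
  fun u (hu : |l u| < c * ‖u‖) =>
    hu.trans_le (mul_le_mul_of_nonneg_right h (norm_nonneg u))

theorem smul_mem_cone {l : (Fin 2 → ℝ) →ₗ[ℝ] ℝ} {c r : ℝ} (hr : 0 < r) {u : Fin 2 → ℝ}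
    (hu : u ∈ cone l c) : r • u ∈ cone l c := by
  rw [mem_cone] at hu ⊢
  rw [map_smul, smul_eq_mul, abs_mul, norm_smul, Real.norm_eq_abs, mul_left_comm]
  exact mul_lt_mul_of_pos_left hu (abs_pos.mpr hr.ne')

theorem exists_norm_le_of_kernels {l l' : (Fin 2 → ℝ) →ₗ[ℝ] ℝ}
    (h : ∀ u, l u = 0 → l' u = 0 → u = 0) :
    ∃ c > 0, ∀ u, c * ‖u‖ ≤ max |l u| |l' u| := by
  have hker : LinearMap.ker (l.prod l') = ⊥ := by
    rw [LinearMap.ker_eq_bot']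
    intro u hu
    exact h u (congrArg Prod.fst hu) (congrArg Prod.snd hu)
  obtain ⟨K, hK, hanti⟩ := LinearMap.exists_antilipschitzWith _ hker
  refine ⟨(K : ℝ)⁻¹, by positivity, fun u => ?_⟩
  have := hanti.le_mul_dist u 0
  rw [map_zero, dist_zero_right, dist_zero_right, Prod.norm_def] at this
  rw [inv_mul_le_iff₀ (by positivity)]
  exact this

open Filter Topology in
/-- Ping-pong with expansion: the `N`-th power of a letter maps the complement of the cone of its
inverse into its own cone and expands there. The second half of the statement moves a given
vector out of all cones. -/
theorem exists_expanding_cones {a b : SL(2, ℤ)} (ha : 3 ≤ |a 0 0 + a 1 1|)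
    (hb : 3 ≤ |b 0 0 + b 1 1|) (hab : a * b ≠ b * a) {u : Fin 2 → ℝ} (hu : u ≠ 0) :
    ∃ (D : Bool × Bool → Set (Fin 2 → ℝ)) (N : ℕ),
      (∀ s s' v, v ∈ D s → v ∈ D s' → s = s') ∧
      (∀ s v, ∀ r > (0 : ℝ), v ∈ D s → r • v ∈ D s) ∧
      (∀ s v, v ≠ 0 → v ∉ D (invLetter s) → realAction (letter a b s ^ N) v ∈ D s ∧
        8 * ‖v‖ ≤ ‖realAction (letter a b s ^ N) v‖) ∧
      ∃ g ∈ Subgroup.closure {a, b}, ∀ s, realAction g u ∉ D s := by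
  obtain ⟨k, l, hk, hl, hl', hind⟩ := exists_letter_functionals ha hb hab
  have hpow : ∀ s n v, l s (realAction (letter a b s ^ n) v) = k s ^ n * l s v := by
    intro s n v
    induction n with
    | zero => simp
    | succ n ih => rw [pow_succ', map_mul, Module.End.mul_apply, hl, ih]; ring
  have hpow' : ∀ s n v, l (invLetter s) (realAction (letter a b s ^ n) v) =
      (k s)⁻¹ ^ n * l (invLetter s) v := by
    intro s n v
    induction n with
    | zero => simp
    | succ n ih => rw [pow_succ', map_mul, Module.End.mul_apply, hl', ih]; ring
  obtain ⟨C, hC, hlC⟩ : ∃ C > 0, ∀ s v, |l s v| ≤ C * ‖v‖ := by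
    refine ⟨1 + ∑ s, ‖LinearMap.toContinuousLinearMap (l s)‖, by positivity, fun s v => ?_⟩
    refine ((LinearMap.toContinuousLinearMap (l s)).le_opNorm v).trans ?_
    gcongr
    have := Finset.single_le_sum
      (f := fun s => ‖LinearMap.toContinuousLinearMap (l s)‖) (fun _ _ => norm_nonneg _)
      (Finset.mem_univ s)
    linarith
  obtain ⟨c₀, hc₀, hdisj₀⟩ : ∃ c₀ > 0, ∀ s s' v, v ∈ cone (l s) c₀ → v ∈ cone (l s') c₀ →
      s = s' := by
    have : ∀ p : (Bool × Bool) × (Bool × Bool), ∃ c > 0, p.1 ≠ p.2 → ∀ u,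
        c * ‖u‖ ≤ max |l p.1 u| |l p.2 u| := by
      rintro ⟨s, s'⟩
      by_cases h : s = s'
      · exact ⟨1, one_pos, fun h' => absurd h h'⟩
      · obtain ⟨c, hc, hcu⟩ := exists_norm_le_of_kernels (hind s s' h)
        exact ⟨c, hc, fun _ => hcu⟩
    choose c hc hcu using this
    obtain ⟨p₀, hp₀⟩ := Finite.exists_min c
    refine ⟨c p₀, hc p₀, fun s s' v h h' => ?_⟩
    by_contra hs
    have h1 := hcu (s, s') hs v
    have h2 := mul_le_mul_of_nonneg_right (hp₀ (s, s')) (norm_nonneg v)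
    exact absurd (h2.trans h1) (not_le.mpr (max_lt h h'))
  have hdisj : ∀ c ≤ c₀, ∀ s s' v, v ∈ cone (l s) c → v ∈ cone (l s') c → s = s' :=
    fun c hc s s' v h h' => hdisj₀ s s' v (cone_mono hc h) (cone_mono hc h')
  have hmap : ∀ c > 0, ∃ N : ℕ, ∀ s v, v ≠ 0 → v ∉ cone (l (invLetter s)) c →
      realAction (letter a b s ^ N) v ∈ cone (l s) c ∧
        8 * ‖v‖ ≤ ‖realAction (letter a b s ^ N) v‖ := by
    intro c hc
    have hN : ∀ s, ∀ᶠ N : ℕ in atTop, C / c * (8 + C / c) ≤ |k s|⁻¹ ^ N := fun s =>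
      (tendsto_pow_atTop_atTop_of_one_lt
        ((one_lt_inv₀ (abs_pos.mpr (hk s).1)).mpr (hk s).2)).eventually_ge_atTop _
    obtain ⟨N, hN⟩ := (eventually_all.mpr hN).exists
    refine ⟨N, fun s v hv hvc => ?_⟩
    have hv0 := norm_pos_iff.mpr hv
    rw [mem_cone, not_lt] at hvc
    have h1 : |k s|⁻¹ ^ N * (c * ‖v‖) ≤ C * ‖realAction (letter a b s ^ N) v‖ := by
      refine le_trans ?_ (hlC (invLetter s) _)
      rw [hpow', abs_mul, abs_pow, abs_inv]
      gcongr
    have h2 : (8 + C / c) * ‖v‖ ≤ ‖realAction (letter a b s ^ N) v‖ := by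
      have h3 := mul_le_mul_of_nonneg_right (hN s) (by positivity : 0 ≤ c * ‖v‖)
      have h4 : C / c * (8 + C / c) * (c * ‖v‖) = C * ((8 + C / c) * ‖v‖) := by
        field_simp
      rw [h4] at h3
      exact le_of_mul_le_mul_left (h3.trans h1) hC
    have h5 : 0 < C / c * ‖v‖ := by positivity
    refine ⟨?_, by linarith⟩
    rw [mem_cone, hpow, abs_mul, abs_pow]
    calc |k s| ^ N * |l s v| ≤ 1 * (C * ‖v‖) := by
          gcongr
          · exact pow_le_one₀ (abs_nonneg _) (hk s).2.le
          · exact hlC s v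
      _ = c * (C / c * ‖v‖) := by field_simp
      _ < c * ‖realAction (letter a b s ^ N) v‖ := by
          gcongr
          linarith
  have hmem : ∀ s, letter a b s ∈ Subgroup.closure {a, b} := by
    have h1 : a ∈ Subgroup.closure {a, b} := Subgroup.subset_closure (by simp)
    have h2 : b ∈ Subgroup.closure {a, b} := Subgroup.subset_closure (by simp)
    rintro ⟨_ | _, _ | _⟩
    exacts [inv_mem h2, h2, inv_mem h1, h1]
  have hcone : ∀ s v, v ≠ 0 → l s v = 0 → v ∈ cone (l s) c₀ := fun s v hv h => by
    rw [mem_cone, h, abs_zero]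
    exact mul_pos hc₀ (norm_pos_iff.mpr hv)
  -- A vector killed by one of the functionals is moved by a power of the other letter.
  obtain ⟨g, hg, hgu⟩ : ∃ g ∈ Subgroup.closure {a, b}, ∀ s, l s (realAction g u) ≠ 0 := by
    by_cases h : ∀ s, l s u ≠ 0
    · exact ⟨1, one_mem _, by simpa using h⟩
    push Not at h
    obtain ⟨s₀, hs₀⟩ := h
    obtain ⟨N, hN⟩ := hmap c₀ hc₀
    let s : Bool × Bool := (!s₀.1, true)
    have hs : s ≠ s₀ := fun h => by simpa [s] using congrArg Prod.fst h
    have hs' : invLetter s ≠ s₀ := fun h => by simpa [s, invLetter] using congrArg Prod.fst h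
    have hin := (hN s u hu fun h => hs' (hdisj₀ _ _ u h (hcone s₀ u hu hs₀))).1
    refine ⟨letter a b s ^ N, pow_mem (hmem s) N, fun s' h' => ?_⟩
    have : s = s' := hdisj₀ _ _ _ hin (hcone s' _ (realAction_ne_zero _ hu) h')
    rw [← this, hpow] at h'
    rcases mul_eq_zero.mp h' with h' | h'
    · exact pow_ne_zero N (hk s).1 h'
    · exact hu (hind s s₀ hs u h' hs₀)
  obtain ⟨s₁, hs₁⟩ := Finite.exists_min fun s => |l s (realAction g u)|
  have hgu0 := norm_pos_iff.mpr (realAction_ne_zero g hu)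
  set c := min c₀ (|l s₁ (realAction g u)| / ‖realAction g u‖)
  have hc : 0 < c := lt_min hc₀ (div_pos (abs_pos.mpr (hgu s₁)) hgu0)
  obtain ⟨N, hN⟩ := hmap c hc
  refine ⟨fun s => cone (l s) c, N, hdisj c (min_le_left _ _), fun s v r hr hv =>
    smul_mem_cone hr hv, hN, g, hg, fun s => ?_⟩
  rw [mem_cone, not_lt]
  calc c * ‖realAction g u‖
      ≤ |l s₁ (realAction g u)| / ‖realAction g u‖ * ‖realAction g u‖ := by
        gcongr; exact min_le_right _ _
    _ = |l s₁ (realAction g u)| := by field_simp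
    _ ≤ _ := hs₁ s

/-! ### Hyperbolic matrices in free groups -/

theorem coe_mul_apply (a b : SL(2, ℤ)) (i j : Fin 2) :
    (a * b) i j = a i 0 * b 0 j + a i 1 * b 1 j := by
  rw [Matrix.SpecialLinearGroup.coe_mul, Matrix.mul_apply, Fin.sum_univ_two]

theorem commute_iff_entries {a b : SL(2, ℤ)} : a * b = b * a ↔ a 0 1 * b 1 0 = a 1 0 * b 0 1 ∧
    a 1 0 * (b 0 0 - b 1 1) = b 1 0 * (a 0 0 - a 1 1) ∧
    a 0 1 * (b 0 0 - b 1 1) = b 0 1 * (a 0 0 - a 1 1) := by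
  constructor
  · intro h
    have e := fun i j => congrArg (fun M : SL(2, ℤ) => M i j) h
    have e00 := e 0 0
    have e01 := e 0 1
    have e10 := e 1 0
    simp only [coe_mul_apply] at e00 e01 e10
    refine ⟨by linarith, by linarith, by linarith⟩
  · rintro ⟨h1, h2, h3⟩
    ext i j
    rw [coe_mul_apply, coe_mul_apply]
    fin_cases i <;> fin_cases j <;> simp <;> linarith

/-- Elliptic matrices have order dividing `12`, by the Cayley-Hamilton theorem. -/
theorem pow_twelve_eq_one {a : SL(2, ℤ)} (ha : |a 0 0 + a 1 1| < 2) : a ^ 12 = 1 := by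
  have hd := det_eq a
  obtain ⟨t, ht⟩ : ∃ t, t = a 0 0 + a 1 1 := ⟨_, rfl⟩
  have hsq : (a : Matrix (Fin 2) (Fin 2) ℤ) ^ 2 =
      t • (a : Matrix (Fin 2) (Fin 2) ℤ) - 1 := by
    ext i j
    rw [pow_two, Matrix.mul_apply, Fin.sum_univ_two, Matrix.sub_apply, Matrix.smul_apply,
      smul_eq_mul, ht]
    fin_cases i <;> fin_cases j <;> simp <;> linarith
  apply Subtype.ext
  rw [Matrix.SpecialLinearGroup.coe_pow, Matrix.SpecialLinearGroup.coe_one]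
  generalize (a : Matrix (Fin 2) (Fin 2) ℤ) = A at hsq
  have ht' : t = 0 ∨ t = 1 ∨ t = -1 := by
    rw [abs_lt] at ha; omega
  rcases ht' with h | h | h <;> rw [h] at hsq
  · rw [zero_smul, zero_sub] at hsq
    rw [show 12 = 2 * 6 from rfl, pow_mul, hsq]; simp [Even.neg_pow (show Even 6 by decide)]
  · have h3 : A ^ 3 = -1 := by
      rw [pow_succ, hsq, one_smul, sub_mul, ← pow_two, hsq]; simp
    rw [show 12 = 3 * 4 from rfl, pow_mul, h3]; simp [Even.neg_pow (show Even 4 by decide)]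
  · have h3 : A ^ 3 = 1 := by
      rw [pow_succ, hsq, sub_mul, smul_mul_assoc, ← pow_two, hsq]; simp
    rw [show 12 = 3 * 4 from rfl, pow_mul, h3, one_pow]

/-- The commutator of two non-commuting parabolic matrices is hyperbolic, by Fricke's trace
identity `tr [a, b] = tr² a + tr² b + tr² ab - tr a · tr b · tr ab - 2`. -/
theorem three_le_abs_trace_commutator {a b : SL(2, ℤ)} (ha : |a 0 0 + a 1 1| = 2)
    (hb : |b 0 0 + b 1 1| = 2) (hab : a * b ≠ b * a) :
    3 ≤ |(a * b * a⁻¹ * b⁻¹) 0 0 + (a * b * a⁻¹ * b⁻¹) 1 1| := by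
  have hda := det_eq a
  have hdb := det_eq b
  have hFricke : (a * b * a⁻¹ * b⁻¹) 0 0 + (a * b * a⁻¹ * b⁻¹) 1 1 =
      (a 0 0 + a 1 1) ^ 2 + (b 0 0 + b 1 1) ^ 2 + ((a * b) 0 0 + (a * b) 1 1) ^ 2 -
      (a 0 0 + a 1 1) * (b 0 0 + b 1 1) * ((a * b) 0 0 + (a * b) 1 1) - 2 := by
    simp only [coe_mul_apply, Matrix.SpecialLinearGroup.coe_inv, Matrix.adjugate_fin_two,
      Matrix.of_apply, Matrix.cons_val_zero, Matrix.cons_val_one, Matrix.cons_val']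
    linear_combination (a 0 0 + a 1 1) ^ 2 * hdb + (b 0 0 + b 1 1) ^ 2 * hda
      - 2 * (b 0 0 * b 1 1 - b 0 1 * b 1 0) * hda - 2 * hdb
  have ha2 : (a 0 0 + a 1 1) ^ 2 = 4 := by rw [← sq_abs, ha]; norm_num
  have hb2 : (b 0 0 + b 1 1) ^ 2 = 4 := by rw [← sq_abs, hb]; norm_num
  set z := (a * b) 0 0 + (a * b) 1 1 with hz
  have hne : 2 * z - (a 0 0 + a 1 1) * (b 0 0 + b 1 1) ≠ 0 := by
    intro h0
    rw [hz, coe_mul_apply, coe_mul_apply] at h0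
    have h1 : (a 0 0 - a 1 1) * (b 0 0 - b 1 1) = -2 * (a 0 1 * b 1 0 + a 1 0 * b 0 1) := by
      linarith
    have da : (a 0 0 - a 1 1) ^ 2 = -4 * (a 0 1 * a 1 0) := by linarith
    have db : (b 0 0 - b 1 1) ^ 2 = -4 * (b 0 1 * b 1 0) := by linarith
    apply hab
    rw [commute_iff_entries]
    refine ⟨?_, ?_, ?_⟩ <;> rw [← sub_eq_zero, ← pow_eq_zero_iff two_ne_zero]
    · apply mul_left_cancel₀ (four_ne_zero' ℤ)
      linear_combination (-(a 0 0 - a 1 1) * (b 0 0 - b 1 1)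
        + 2 * (a 0 1 * b 1 0 + a 1 0 * b 0 1)) * h1
        + (b 0 0 - b 1 1) ^ 2 * da - 4 * (a 0 1 * a 1 0) * db
    · linear_combination (a 1 0) ^ 2 * db + (b 1 0) ^ 2 * da - 2 * (a 1 0) * (b 1 0) * h1
    · linear_combination (a 0 1) ^ 2 * db + (b 0 1) ^ 2 * da - 2 * (a 0 1) * (b 0 1) * h1
  have hpos := Int.one_le_abs hne
  have hsq : 4 * ((a * b * a⁻¹ * b⁻¹) 0 0 + (a * b * a⁻¹ * b⁻¹) 1 1) =
      (2 * z - (a 0 0 + a 1 1) * (b 0 0 + b 1 1)) ^ 2 + 8 := by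
    rw [hFricke]
    linear_combination (4 - (b 0 0 + b 1 1) ^ 2) * ha2
  refine le_trans ?_ (le_abs_self _)
  rw [← sq_abs] at hsq
  nlinarith

/-- A matrix commuting with a hyperbolic one has the same eigenlines; if the traces agree as well,
the eigenvalues are equal or swapped. -/
theorem eq_or_eq_inv_of_commute {a b : SL(2, ℤ)} (ha : 3 ≤ |a 0 0 + a 1 1|)
    (htr : b 0 0 + b 1 1 = a 0 0 + a 1 1) (hab : a * b = b * a) : b = a ∨ b = a⁻¹ := by
  obtain ⟨h1, h2, h3⟩ := commute_iff_entries.mp hab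
  have hda := det_eq a
  have hdb := det_eq b
  have hr : a 1 0 ≠ 0 := by
    intro h
    rw [h, mul_zero, sub_zero] at hda
    rcases Int.eq_one_or_neg_one_of_mul_eq_one' hda with h | h <;> rw [h.1, h.2] at ha <;>
      norm_num at ha
  have ht : (a 0 0 + a 1 1) ^ 2 - 4 ≠ 0 := by
    rw [← sq_abs]; nlinarith
  have hsq : b 1 0 ^ 2 = a 1 0 ^ 2 := by
    apply mul_right_cancel₀ ht
    linear_combination 4 * (b 1 0) ^ 2 * hda - 4 * (a 1 0) ^ 2 * hdb
      + 4 * (a 1 0) * (b 1 0) * h1 + (a 1 0) ^ 2 * (b 0 0 + b 1 1 + a 0 0 + a 1 1) * htr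
      - (a 1 0 * (b 0 0 - b 1 1) + b 1 0 * (a 0 0 - a 1 1)) * h2
  rcases sq_eq_sq_iff_eq_or_eq_neg.mp hsq with h | h
  · left
    rw [h] at h1 h2
    have e1 : b 0 1 = a 0 1 := mul_left_cancel₀ hr (by linarith)
    have e2 := mul_left_cancel₀ hr h2
    ext i j
    fin_cases i <;> fin_cases j <;> simp <;> linarith
  · right
    rw [h] at h1 h2
    have e1 : b 0 1 = - a 0 1 := mul_left_cancel₀ hr (by linarith)
    have e2 : b 0 0 - b 1 1 = -(a 0 0 - a 1 1) := mul_left_cancel₀ hr (by linarith)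
    ext i j
    fin_cases i <;> fin_cases j <;>
      simp [Matrix.SpecialLinearGroup.coe_inv, Matrix.adjugate_fin_two] <;> linarith

theorem commute_of_commute_hyperbolic {a b c : SL(2, ℤ)} (ha : 3 ≤ |a 0 0 + a 1 1|)
    (hb : a * b = b * a) (hc : a * c = c * a) : b * c = c * b := by
  obtain ⟨h1, h2, h3⟩ := commute_iff_entries.mp hb
  obtain ⟨k1, k2, k3⟩ := commute_iff_entries.mp hc
  have hda := det_eq a
  have hr : a 1 0 ≠ 0 := by
    intro h
    rw [h, mul_zero, sub_zero] at hda
    rcases Int.eq_one_or_neg_one_of_mul_eq_one' hda with h | h <;> rw [h.1, h.2] at ha <;>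
      norm_num at ha
  rw [commute_iff_entries]
  refine ⟨?_, ?_, ?_⟩
  · apply mul_left_cancel₀ hr
    linear_combination b 1 0 * k1 - c 1 0 * h1
  · apply mul_left_cancel₀ hr
    linear_combination b 1 0 * k2 - c 1 0 * h2
  · apply mul_left_cancel₀ (mul_ne_zero hr hr)
    linear_combination (a 1 0 * b 0 1) * k2 - (a 1 0 * c 0 1) * h2
      + (a 0 0 - a 1 1) * (-c 1 0 * h1 + b 1 0 * k1)

/-- A free subgroup of rank at least two contains two non-commuting hyperbolic matrices: a generator
or a commutator of generators is hyperbolic, and if a hyperbolic matrix commuted with all its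
conjugates, then it would commute with the squares of all generators, and so would these squares
with each other. -/
theorem exists_hyperbolic_pair {F : Subgroup SL(2, ℤ)} {ι : Type*} [Nontrivial ι]
    (B : FreeGroupBasis ι F) : ∃ a ∈ F, ∃ b ∈ F,
      3 ≤ |a 0 0 + a 1 1| ∧ 3 ≤ |b 0 0 + b 1 1| ∧ a * b ≠ b * a := by
  classical
  obtain ⟨i, j, hij⟩ := exists_pair_ne ι
  have htors : ∀ i, (B i : SL(2, ℤ)) ^ 12 ≠ 1 := by
    intro i h
    have h' : B i ^ 12 = 1 := Subtype.ext h
    have hf : B.lift (fun _ => Multiplicative.ofAdd (1 : ℤ)) (B i) = .ofAdd 1 := by simp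
    have := congrArg (B.lift fun _ => Multiplicative.ofAdd (1 : ℤ)) h'
    rw [map_pow, hf, (B.lift _).map_one] at this
    exact absurd this (by decide)
  have hsq : (B i : SL(2, ℤ)) ^ 2 * (B j : SL(2, ℤ)) ^ 2 ≠
      (B j : SL(2, ℤ)) ^ 2 * (B i : SL(2, ℤ)) ^ 2 := by
    intro h
    have h' : B i ^ 2 * B j ^ 2 = B j ^ 2 * B i ^ 2 := Subtype.ext h
    let p : ι → Equiv.Perm (Fin 4) := fun k =>
      if k = i then Equiv.swap 0 1 * Equiv.swap 1 2 else Equiv.swap 0 1 * Equiv.swap 1 3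
    have hi : B.lift p (B i) = Equiv.swap 0 1 * Equiv.swap 1 2 := by simp [p]
    have hj : B.lift p (B j) = Equiv.swap 0 1 * Equiv.swap 1 3 := by simp [p, hij.symm]
    have := congrArg (B.lift p) h'
    rw [map_mul, map_mul, map_pow, map_pow, hi, hj] at this
    exact absurd this (by decide)
  have hcomm : (B i : SL(2, ℤ)) * B j ≠ B j * B i := by
    intro h
    exact hsq (((show Commute (B i : SL(2, ℤ)) (B j) from h).pow_pow 2 2).eq)
  obtain ⟨a, haF, ha⟩ : ∃ a ∈ F, 3 ≤ |a 0 0 + a 1 1| := by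
    by_contra! hno
    have h2 : ∀ i, |(B i : SL(2, ℤ)) 0 0 + (B i : SL(2, ℤ)) 1 1| = 2 := by
      intro i
      have h1 := hno (B i) (B i).2
      by_contra hne
      exact htors i (pow_twelve_eq_one (by omega))
    refine absurd (three_le_abs_trace_commutator (h2 i) (h2 j) hcomm) (not_le.mpr (hno _ ?_))
    exact mul_mem (mul_mem (mul_mem (B i).2 (B j).2) (inv_mem (B i).2)) (inv_mem (B j).2)
  refine ⟨a, haF, ?_⟩
  by_contra! hno
  have htr : ∀ g : SL(2, ℤ), (g * a * g⁻¹) 0 0 + (g * a * g⁻¹) 1 1 = a 0 0 + a 1 1 := by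
    intro g
    have h1 : ∀ M : SL(2, ℤ), M 0 0 + M 1 1 = Matrix.trace (M : Matrix (Fin 2) (Fin 2) ℤ) :=
      fun M => (Matrix.trace_fin_two _).symm
    rw [h1, h1, Matrix.SpecialLinearGroup.coe_mul, Matrix.trace_mul_comm,
      ← Matrix.SpecialLinearGroup.coe_mul, inv_mul_cancel_left]
  have hsqcomm : ∀ g ∈ F, a * g ^ 2 = g ^ 2 * a := by
    intro g hg
    have h := eq_or_eq_inv_of_commute ha (htr g)
      (hno _ (mul_mem (mul_mem hg haF) (inv_mem hg)) ha (by rwa [htr g]))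
    rcases h with h | h
    · have h' : g * a = a * g := by rwa [mul_inv_eq_iff_eq_mul] at h
      exact ((show Commute a g from h'.symm).pow_right 2).eq
    · have h' : g * a = a⁻¹ * g := by rwa [mul_inv_eq_iff_eq_mul] at h
      have h'' : g * a⁻¹ = a * g := by
        rw [mul_inv_eq_iff_eq_mul, mul_assoc, h', mul_inv_cancel_left]
      rw [pow_two, mul_assoc g g a, h', ← mul_assoc g, h'', mul_assoc]
  exact hsq (commute_of_commute_hyperbolic ha (hsqcomm _ (B i).2) (hsqcomm _ (B j).2))

/-! ### Components of the action of `ℤ²` -/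

section Components

variable {F : Subgroup SL(2, ℤ)}

/-- The permutation of `ℝ` by which a vector of `ℤ²` acts. -/
def latticeMap (φ : LinearSemidirect F →* Equiv.Perm ℝ) (v : Fin 2 → ℤ) : Equiv.Perm ℝ :=
  φ (SemidirectProduct.inl (.ofAdd v))

/-- The permutation of `ℝ` by which a matrix in `F` acts. -/
def matrixMap (φ : LinearSemidirect F →* Equiv.Perm ℝ) (f : F) : Equiv.Perm ℝ :=
  φ (SemidirectProduct.inr f)

variable {φ : LinearSemidirect F →* Equiv.Perm ℝ}

theorem latticeMap_add (v w : Fin 2 → ℤ) (x : ℝ) :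
    latticeMap φ (v + w) x = latticeMap φ v (latticeMap φ w x) := by
  rw [latticeMap, ofAdd_add, map_mul, map_mul]; rfl

theorem latticeMap_zero (x : ℝ) : latticeMap φ 0 x = x := by
  rw [latticeMap, ofAdd_zero, map_one, map_one]; rfl

theorem latticeMap_neg_apply (v : Fin 2 → ℤ) (x : ℝ) :
    latticeMap φ (-v) (latticeMap φ v x) = x := by
  rw [← latticeMap_add, neg_add_cancel, latticeMap_zero]

theorem latticeMap_apply_neg (v : Fin 2 → ℤ) (x : ℝ) :
    latticeMap φ v (latticeMap φ (-v) x) = x := by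
  rw [← latticeMap_add, add_neg_cancel, latticeMap_zero]

theorem latticeMap_comm (v w : Fin 2 → ℤ) (x : ℝ) :
    latticeMap φ v (latticeMap φ w x) = latticeMap φ w (latticeMap φ v x) := by
  rw [← latticeMap_add, add_comm, latticeMap_add]

theorem matrixMap_mul (f g : F) (x : ℝ) :
    matrixMap φ (f * g) x = matrixMap φ f (matrixMap φ g x) := by
  rw [matrixMap, map_mul, map_mul]; rfl

theorem matrixMap_id (x : ℝ) : matrixMap φ 1 x = x := by
  rw [matrixMap, map_one, map_one]; rfl

theorem matrixMap_inv_apply (f : F) (x : ℝ) : matrixMap φ f⁻¹ (matrixMap φ f x) = x := by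
  rw [← matrixMap_mul, inv_mul_cancel, matrixMap_id]

theorem matrixMap_apply_inv (f : F) (x : ℝ) : matrixMap φ f (matrixMap φ f⁻¹ x) = x := by
  rw [← matrixMap_mul, mul_inv_cancel, matrixMap_id]

theorem matrixMap_latticeMap (f : F) (v : Fin 2 → ℤ) (x : ℝ) :
    matrixMap φ f (latticeMap φ v x) =
      latticeMap φ (((f : SL(2, ℤ)) : Matrix (Fin 2) (Fin 2) ℤ).mulVec v) (matrixMap φ f x) := by
  have h : (SemidirectProduct.inr f * SemidirectProduct.inl (.ofAdd v) : LinearSemidirect F) =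
      SemidirectProduct.inl (linearAction F f (.ofAdd v)) * SemidirectProduct.inr f := by
    rw [SemidirectProduct.inl_aut, map_inv, inv_mul_cancel_right]
  have h' := congrArg (fun g => φ g x) h
  simp only [map_mul, Equiv.Perm.mul_apply] at h'
  exact h'

theorem IsC1Action.latticeMap_strictMono (h : IsC1Action φ) (v : Fin 2 → ℤ) :
    StrictMono (latticeMap φ v) := h.strictMono _

theorem IsC1Action.matrixMap_strictMono (h : IsC1Action φ) (f : F) :
    StrictMono (matrixMap φ f) := h.strictMono _

theorem IsC1Action.continuous {G : Type*} [Group G] {φ : G →* Equiv.Perm ℝ} (h : IsC1Action φ)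
    (g : G) : Continuous (φ g) :=
  (h.strictMono g).monotone.continuous_of_surjective (φ g).surjective

theorem mem_of_basis_mem (S : AddSubgroup (Fin 2 → ℤ)) (h : ∀ i, Pi.single i 1 ∈ S)
    (v : Fin 2 → ℤ) : v ∈ S := by
  have : v = v 0 • Pi.single 0 1 + v 1 • Pi.single 1 1 := by
    ext i; fin_cases i <;> simp
  rw [this]
  exact add_mem (zsmul_mem (h 0) _) (zsmul_mem (h 1) _)

theorem latticeMap_eq_self_of_basis {x : ℝ} (h : ∀ i, latticeMap φ (Pi.single i 1) x = x)
    (v : Fin 2 → ℤ) : latticeMap φ v x = x :=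
  mem_of_basis_mem
    { carrier := {v | latticeMap φ v x = x}
      add_mem' := fun {a b} (ha : latticeMap φ a x = x) (hb : latticeMap φ b x = x) => by
        change latticeMap φ (a + b) x = x
        rw [latticeMap_add, hb, ha]
      zero_mem' := latticeMap_zero x
      neg_mem' := fun {a} (ha : latticeMap φ a x = x) => by
        change latticeMap φ (-a) x = x
        conv_lhs => rw [← ha]
        exact latticeMap_neg_apply a x } h v

/-- The interval `]p, q[` is a connected component of the complement of the set of global fixed
points of `ℤ²`. -/
structure IsComponent (φ : LinearSemidirect F →* Equiv.Perm ℝ) (p q : ℝ) : Prop where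
  lt : p < q
  left : ∀ v, latticeMap φ v p = p
  right : ∀ v, latticeMap φ v q = q
  exists_ne : ∀ x ∈ Set.Ioo p q, ∃ v, latticeMap φ v x ≠ x

theorem IsComponent.latticeMap_mem {p q : ℝ} (hJ : IsComponent φ p q) (h : IsC1Action φ)
    (v : Fin 2 → ℤ) {x : ℝ} (hx : x ∈ Set.Ioo p q) : latticeMap φ v x ∈ Set.Ioo p q :=
  ⟨by simpa [hJ.left v] using h.latticeMap_strictMono v hx.1,
    by simpa [hJ.right v] using h.latticeMap_strictMono v hx.2⟩

theorem IsComponent.image {p q : ℝ} (hJ : IsComponent φ p q) (h : IsC1Action φ) (f : F) :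
    IsComponent φ (matrixMap φ f p) (matrixMap φ f q) where
  lt := h.matrixMap_strictMono f hJ.lt
  left v := by
    rw [← matrixMap_inv_apply f⁻¹ (latticeMap φ v _), matrixMap_latticeMap, matrixMap_inv_apply,
      hJ.left, inv_inv]
  right v := by
    rw [← matrixMap_inv_apply f⁻¹ (latticeMap φ v _), matrixMap_latticeMap, matrixMap_inv_apply,
      hJ.right, inv_inv]
  exists_ne x hx := by
    have hx' : matrixMap φ f⁻¹ x ∈ Set.Ioo p q := by
      have h1 := h.matrixMap_strictMono f⁻¹ hx.1
      have h2 := h.matrixMap_strictMono f⁻¹ hx.2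
      rw [matrixMap_inv_apply] at h1 h2
      exact ⟨h1, h2⟩
    obtain ⟨v, hv⟩ := hJ.exists_ne _ hx'
    refine ⟨((f : SL(2, ℤ)) : Matrix (Fin 2) (Fin 2) ℤ).mulVec v, fun hfix => hv ?_⟩
    have := matrixMap_latticeMap (φ := φ) f v (matrixMap φ f⁻¹ x)
    rw [matrixMap_apply_inv, hfix] at this
    exact (matrixMap φ f).injective (this.trans (matrixMap_apply_inv f x).symm)

theorem IsComponent.right_le_left {p q p' q' : ℝ} (hJ : IsComponent φ p q)
    (hJ' : IsComponent φ p' q') (h : p < p') : q ≤ p' := by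
  by_contra! hlt
  obtain ⟨v, hv⟩ := hJ.exists_ne p' ⟨h, hlt⟩
  exact hv (hJ'.left v)

theorem IsComponent.right_le_right {p q p' q' : ℝ} (hJ : IsComponent φ p q)
    (hJ' : IsComponent φ p' q') (h : p ≤ p') : q ≤ q' := by
  by_contra! hlt
  obtain ⟨v, hv⟩ := hJ.exists_ne q' ⟨h.trans_lt hJ'.lt, hlt⟩
  exact hv (hJ'.right v)

theorem isClosed_globalFixed (h : IsC1Action φ) :
    IsClosed {x : ℝ | ∀ v, latticeMap φ v x = x} := by
  have : {x : ℝ | ∀ v, latticeMap φ v x = x} = ⋂ v, {x | latticeMap φ v x = x} := by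
    ext x; simp
  rw [this]
  exact isClosed_iInter fun v => isClosed_eq (h.continuous _) continuous_id

/-- A point that is not fixed by `ℤ²` lies between the closest global fixed points; both `0` and `1`
are global fixed points. -/
theorem exists_isComponent (h : IsC1Action φ) {w : Fin 2 → ℤ} (hw : latticeMap φ w ≠ 1) :
    ∃ p q, IsComponent φ p q ∧ 0 ≤ p ∧ q ≤ 1 := by
  obtain ⟨x, hx⟩ : ∃ x, latticeMap φ w x ≠ x := by
    by_contra! hno
    exact hw (Equiv.ext hno)
  have hx01 : x ∈ Set.Ioo (0 : ℝ) 1 := by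
    by_contra hno
    exact hx (h.apply_eq_self _ x hno)
  set S := {x : ℝ | ∀ v, latticeMap φ v x = x} with hS
  have hxS : x ∉ S := fun hxS => hx (hxS w)
  have h0 : (0 : ℝ) ∈ S := fun v => h.apply_eq_self _ 0 (by simp)
  have h1 : (1 : ℝ) ∈ S := fun v => h.apply_eq_self _ 1 (by simp)
  have hA : IsClosed (S ∩ Set.Iic x) := (isClosed_globalFixed h).inter isClosed_Iic
  have hB : IsClosed (S ∩ Set.Ici x) := (isClosed_globalFixed h).inter isClosed_Ici
  have hAb : BddAbove (S ∩ Set.Iic x) := ⟨x, fun _ hy => hy.2⟩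
  have hBb : BddBelow (S ∩ Set.Ici x) := ⟨x, fun _ hy => hy.2⟩
  have hp := hA.csSup_mem ⟨0, h0, hx01.1.le⟩ hAb
  have hq := hB.csInf_mem ⟨1, h1, hx01.2.le⟩ hBb
  have hpx : sSup (S ∩ Set.Iic x) < x := lt_of_le_of_ne hp.2 fun he => hxS (he ▸ hp.1)
  have hxq : x < sInf (S ∩ Set.Ici x) :=
    lt_of_le_of_ne hq.2 fun he => hxS (by rw [he]; exact hq.1)
  refine ⟨_, _, ⟨hpx.trans hxq, hp.1, hq.1, fun y hy => ?_⟩, le_csSup hAb ⟨h0, hx01.1.le⟩,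
    csInf_le hBb ⟨h1, hx01.2.le⟩⟩
  by_contra! hyS
  rcases le_total y x with hyx | hyx
  · exact absurd (le_csSup hAb ⟨hyS, hyx⟩) (not_le.mpr hy.1)
  · exact absurd (csInf_le hBb ⟨hyS, hyx⟩) (not_le.mpr hy.2)

/-- Commuting increasing maps which both have fixed points have a common one in between. -/
theorem exists_common_fixed (h : IsC1Action φ) {v w : Fin 2 → ℤ} {y z : ℝ} (hyz : y ≤ z)
    (hy : latticeMap φ v y = y) (hz : latticeMap φ w z = z) :
    ∃ s ∈ Set.Icc y z, latticeMap φ v s = s ∧ latticeMap φ w s = s := by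
  set A := {x | latticeMap φ v x = x} ∩ Set.Iic z with hA
  have hAc : IsClosed A := (isClosed_eq (h.continuous _) continuous_id).inter isClosed_Iic
  have hAb : BddAbove A := ⟨z, fun _ hx => hx.2⟩
  have hyA : y ∈ A := ⟨hy, hyz⟩
  have hs := hAc.csSup_mem ⟨y, hyA⟩ hAb
  have hz' : latticeMap φ (-w) z = z := by
    conv_lhs => rw [← hz]
    exact latticeMap_neg_apply w z
  have hinv : ∀ w', latticeMap φ w' z = z → latticeMap φ w' (sSup A) ≤ sSup A := fun w' hw' =>
    le_csSup hAb ⟨by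
      change latticeMap φ v _ = _
      rw [latticeMap_comm, hs.1], by
      simpa [hw'] using (h.latticeMap_strictMono w').monotone hs.2⟩
  -- The largest fixed point of `v` to the left of `z` is preserved by `w`.
  refine ⟨sSup A, ⟨le_csSup hAb hyA, hs.2⟩, hs.1, le_antisymm (hinv w hz) ?_⟩
  simpa [latticeMap_apply_neg] using (h.latticeMap_strictMono w).monotone (hinv (-w) hz')

/-- On a component, one of the two generators of `ℤ²` has no fixed points, since otherwise they
would have a common one. -/
theorem IsComponent.exists_lt_latticeMap {p q : ℝ} (hJ : IsComponent φ p q) (h : IsC1Action φ) :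
    ∃ t, ∀ x ∈ Set.Ioo p q, x < latticeMap φ t x := by
  obtain ⟨i, hi⟩ : ∃ i, ∀ x ∈ Set.Ioo p q, latticeMap φ (Pi.single i 1) x ≠ x := by
    by_contra! hno
    obtain ⟨y, hyJ, hy⟩ := hno 0
    obtain ⟨z, hzJ, hz⟩ := hno 1
    obtain ⟨s, hsJ, hs0, hs1⟩ : ∃ s ∈ Set.Ioo p q, latticeMap φ (Pi.single 0 1) s = s ∧
        latticeMap φ (Pi.single 1 1) s = s := by
      rcases le_total y z with hyz | hyz
      · obtain ⟨s, hs, h0, h1⟩ := exists_common_fixed h hyz hy hz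
        exact ⟨s, ⟨hyJ.1.trans_le hs.1, hs.2.trans_lt hzJ.2⟩, h0, h1⟩
      · obtain ⟨s, hs, h1, h0⟩ := exists_common_fixed h hyz hz hy
        exact ⟨s, ⟨hzJ.1.trans_le hs.1, hs.2.trans_lt hyJ.2⟩, h0, h1⟩
    obtain ⟨v, hv⟩ := hJ.exists_ne s hsJ
    exact hv (latticeMap_eq_self_of_basis (Fin.forall_fin_two.mpr ⟨hs0, hs1⟩) v)
  by_cases hpos : ∀ x ∈ Set.Ioo p q, x < latticeMap φ (Pi.single i 1) x
  · exact ⟨_, hpos⟩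
  push Not at hpos
  obtain ⟨x, hxJ, hx⟩ := hpos
  have hneg : ∀ y ∈ Set.Ioo p q, latticeMap φ (Pi.single i 1) y < y := by
    intro y hy
    by_contra! hy'
    obtain ⟨c, hc, hc'⟩ := isPreconnected_Ioo.intermediate_value₂ hxJ hy
      (h.continuous _).continuousOn continuousOn_id hx hy'
    exact hi c hc hc'
  refine ⟨-Pi.single i 1, fun y hy => ?_⟩
  simpa [latticeMap_apply_neg] using hneg _ (hJ.latticeMap_mem h (-Pi.single i 1) hy)

end Components

/-! ### Directions of components -/

section Directions

variable {F : Subgroup SL(2, ℤ)} {φ : LinearSemidirect F →* Equiv.Perm ℝ}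

theorem lt_nsmul_unbounded (h : IsC1Action φ) {p q : ℝ} (hJ : IsComponent φ p q)
    {t : Fin 2 → ℤ} (ht : ∀ x ∈ Set.Ioo p q, x < latticeMap φ t x) {x y : ℝ}
    (hx : x ∈ Set.Ioo p q) (hy : y ∈ Set.Ioo p q) : ∃ n : ℕ, y < latticeMap φ (n • t) x := by
  by_contra! hno
  have hbdd : BddAbove (Set.range fun n : ℕ => latticeMap φ (n • t) x) :=
    ⟨y, by rintro _ ⟨n, rfl⟩; exact hno n⟩
  set s := ⨆ n : ℕ, latticeMap φ (n • t) x with hs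
  have hsJ : s ∈ Set.Ioo p q := by
    constructor
    · refine hx.1.trans_le ?_
      have := le_ciSup hbdd 0
      rwa [zero_smul, latticeMap_zero] at this
    · exact (ciSup_le hno).trans_lt hy.2
  have hlt : latticeMap φ (-t) s < s := by
    simpa [latticeMap_apply_neg] using ht _ (hJ.latticeMap_mem h (-t) hsJ)
  obtain ⟨n, hn⟩ := exists_lt_of_lt_ciSup hlt
  have h1 := h.latticeMap_strictMono t hn
  rw [latticeMap_apply_neg, ← latticeMap_add, ← succ_nsmul'] at h1
  exact absurd (le_ciSup hbdd (n + 1)) (not_le.mpr h1)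

theorem latticeMap_nsmul_le (h : IsC1Action φ) {v : Fin 2 → ℤ} {x : ℝ}
    (hx : latticeMap φ v x ≤ x) (n : ℕ) : latticeMap φ (n • v) x ≤ x := by
  induction n with
  | zero => rw [zero_smul, latticeMap_zero]
  | succ n ih =>
    rw [succ_nsmul, latticeMap_add]
    exact ((h.latticeMap_strictMono _).monotone hx).trans ih

/-- A nonzero vector `u` is a direction of the component `]p, q[` if every lattice vector on its
positive side, with respect to the area form, acts on `]p, q[` by moving all points to the right. -/
def IsDirection (φ : LinearSemidirect F →* Equiv.Perm ℝ) (p q : ℝ) (u : Fin 2 → ℝ) : Prop :=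
  u ≠ 0 ∧ ∀ v, 0 < cross u v → ∀ x ∈ Set.Ioo p q, x < latticeMap φ v x

open Filter Topology in
/-- The direction of a component is given by the translation number relative to an element without
fixed points there: the number of its fundamental domains crossed by `n v`, divided by `n`,
converges by Fekete's lemma to an additive function of `v`. -/
theorem IsComponent.exists_isDirection {p q : ℝ} (hJ : IsComponent φ p q) (h : IsC1Action φ) :
    ∃ u, IsDirection φ p q u := by
  obtain ⟨t, ht⟩ := hJ.exists_lt_latticeMap h
  obtain ⟨x₀, hx₀⟩ : (Set.Ioo p q).Nonempty := Set.nonempty_Ioo.mpr hJ.lt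
  have hmono : StrictMono fun k : ℤ => latticeMap φ (k • t) x₀ := by
    refine strictMono_int_of_lt_succ fun k => ?_
    rw [add_comm, add_zsmul, one_zsmul, latticeMap_add]
    exact ht _ (hJ.latticeMap_mem h _ hx₀)
  -- `N v` is the number of fundamental domains of `t` between `x₀` and its image under `v`.
  have hfloor : ∀ v, ∃ k : ℤ, latticeMap φ (k • t) x₀ ≤ latticeMap φ v x₀ ∧
      latticeMap φ v x₀ < latticeMap φ ((k + 1) • t) x₀ := by
    intro v
    have hv := hJ.latticeMap_mem h v hx₀
    obtain ⟨k, hk, hk'⟩ := Int.exists_greatest_of_bdd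
      (P := fun k : ℤ => latticeMap φ (k • t) x₀ ≤ latticeMap φ v x₀) (by
        obtain ⟨n, hn⟩ := lt_nsmul_unbounded h hJ ht hx₀ hv
        refine ⟨n, fun k hk => ?_⟩
        rw [← natCast_zsmul] at hn
        exact (hmono.lt_iff_lt.mp (hk.trans_lt hn)).le) (by
        obtain ⟨n, hn⟩ := lt_nsmul_unbounded h hJ ht hv hx₀
        refine ⟨-(n : ℤ), ?_⟩
        have := (h.latticeMap_strictMono (-(n • t))).le_iff_le.mpr hn.le
        rwa [latticeMap_neg_apply, ← natCast_zsmul, ← neg_zsmul] at this)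
    refine ⟨k, hk, ?_⟩
    by_contra! hle
    have := hk' (k + 1) hle
    omega
  choose N hN hN' using hfloor
  have hlow : ∀ v w, N v + N w ≤ N (v + w) := by
    intro v w
    have h1 : latticeMap φ ((N v + N w) • t) x₀ ≤ latticeMap φ (v + w) x₀ := by
      rw [add_zsmul, latticeMap_add, latticeMap_add]
      calc _ ≤ latticeMap φ (N v • t) (latticeMap φ w x₀) :=
            (h.latticeMap_strictMono _).monotone (hN w)
        _ = latticeMap φ w (latticeMap φ (N v • t) x₀) := latticeMap_comm _ _ _
        _ ≤ latticeMap φ w (latticeMap φ v x₀) := (h.latticeMap_strictMono _).monotone (hN v)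
        _ = _ := latticeMap_comm _ _ _
    have := hmono.lt_iff_lt.mp (h1.trans_lt (hN' (v + w)))
    omega
  have hupp : ∀ v w, N (v + w) ≤ N v + N w + 1 := by
    intro v w
    have h1 : latticeMap φ (v + w) x₀ < latticeMap φ ((N v + 1 + (N w + 1)) • t) x₀ := by
      rw [add_zsmul, latticeMap_add, latticeMap_add]
      calc _ < latticeMap φ v (latticeMap φ ((N w + 1) • t) x₀) :=
            h.latticeMap_strictMono _ (hN' w)
        _ = latticeMap φ ((N w + 1) • t) (latticeMap φ v x₀) := latticeMap_comm _ _ _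
        _ < latticeMap φ ((N w + 1) • t) (latticeMap φ ((N v + 1) • t) x₀) :=
            h.latticeMap_strictMono _ (hN' v)
        _ = _ := latticeMap_comm _ _ _
    have := hmono.lt_iff_lt.mp ((hN (v + w)).trans_lt h1)
    omega
  have hNt : ∀ k : ℤ, N (k • t) = k := fun k => by
    have h1 := hmono.le_iff_le.mp (hN (k • t))
    have h2 := hmono.lt_iff_lt.mp (hN' (k • t))
    omega
  have hN0 : N 0 = 0 := by simpa using hNt 0
  have hlim : ∀ v, ∃ L : ℝ, Tendsto (fun n : ℕ => (N (n • v) : ℝ) / n) atTop (𝓝 L) := by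
    intro v
    have hsub : Subadditive fun n : ℕ => -(N (n • v) : ℝ) := by
      intro m n
      have := hlow (m • v) (n • v)
      rw [← add_smul] at this
      have : (N (m • v) : ℝ) + N (n • v) ≤ N ((m + n) • v) := by exact_mod_cast this
      linarith
    have hle : ∀ n : ℕ, (N (n • v) : ℝ) ≤ n * (|(N v : ℝ)| + 1) := by
      intro n
      induction n with
      | zero => simp [hN0]
      | succ n ih =>
        have h1 := hupp (n • v) v
        rw [← succ_nsmul] at h1
        have h1 : (N ((n + 1) • v) : ℝ) ≤ N (n • v) + N v + 1 := by exact_mod_cast h1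
        push_cast
        linarith [le_abs_self (N v : ℝ)]
    have hbdd : BddBelow (Set.range fun n : ℕ => -(N (n • v) : ℝ) / n) := by
      refine ⟨-(|(N v : ℝ)| + 1), ?_⟩
      rintro _ ⟨n, rfl⟩
      rcases Nat.eq_zero_or_pos n with rfl | hn
      · simp only [Nat.cast_zero, div_zero]
        linarith [abs_nonneg (N v : ℝ)]
      · have hn' : (0 : ℝ) < n := by exact_mod_cast hn
        simp only
        rw [le_div_iff₀ hn']
        linarith [hle n]
    refine ⟨-hsub.lim, (hsub.tendsto_lim hbdd).neg.congr fun n => ?_⟩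
    ring
  choose τ hτ using hlim
  have hadd : ∀ v w, τ (v + w) = τ v + τ w := by
    intro v w
    have h0 : Tendsto (fun n : ℕ => (N (n • (v + w)) : ℝ) / n - (N (n • v) : ℝ) / n
        - (N (n • w) : ℝ) / n) atTop (𝓝 0) := by
      refine squeeze_zero (g := fun n : ℕ => 1 / (n : ℝ)) (fun n => ?_) (fun n => ?_)
        tendsto_one_div_atTop_nhds_zero_nat
      · have := hlow (n • v) (n • w)
        rw [← smul_add] at this
        have : (N (n • v) : ℝ) + N (n • w) ≤ N (n • (v + w)) := by exact_mod_cast this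
        rw [← sub_div, ← sub_div]
        exact div_nonneg (by linarith) (Nat.cast_nonneg n)
      · have := hupp (n • v) (n • w)
        rw [← smul_add] at this
        have : (N (n • (v + w)) : ℝ) ≤ N (n • v) + N (n • w) + 1 := by exact_mod_cast this
        rw [← sub_div, ← sub_div]
        exact div_le_div_of_nonneg_right (by linarith) (Nat.cast_nonneg n)
    have := tendsto_nhds_unique h0 (((hτ (v + w)).sub (hτ v)).sub (hτ w))
    linarith
  have hτt : τ t = 1 := by
    refine tendsto_nhds_unique (hτ t) ?_
    refine (tendsto_const_nhds (x := (1 : ℝ))).congr' ?_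
    filter_upwards [eventually_gt_atTop 0] with n hn
    rw [← natCast_zsmul, hNt]
    have : (n : ℝ) ≠ 0 := by positivity
    simp [this]
  set u : Fin 2 → ℝ := ![τ (Pi.single 1 1), - τ (Pi.single 0 1)] with hu
  have hcross : ∀ v, τ v = cross u v := by
    let T : (Fin 2 → ℤ) →+ ℝ := AddMonoidHom.mk' τ hadd
    let C : (Fin 2 → ℤ) →+ ℝ := AddMonoidHom.mk' (cross u) (cross_add u)
    refine fun v => mem_of_basis_mem (T.eqLocus C) (Fin.forall_fin_two.mpr ⟨?_, ?_⟩) v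
    · change τ _ = cross u _
      simp [cross, hu]
    · change τ _ = cross u _
      simp [cross, hu]
  refine ⟨u, fun h0 => ?_, fun v hv x hx => ?_⟩
  · have := hcross t
    rw [hτt, h0] at this
    simp [cross] at this
  by_contra! hle
  rw [← hcross] at hv
  obtain ⟨i, hi⟩ := lt_nsmul_unbounded h hJ ht hx₀ hx
  obtain ⟨j, hj⟩ := lt_nsmul_unbounded h hJ ht hx hx₀
  have hlarge : Tendsto (fun n : ℕ => (N (n • v) : ℝ)) atTop atTop := by
    refine ((hτ v).pos_mul_atTop hv tendsto_natCast_atTop_atTop).congr' ?_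
    filter_upwards [eventually_gt_atTop 0] with n hn
    have : (n : ℝ) ≠ 0 := by positivity
    field_simp
  obtain ⟨n, hn⟩ := (hlarge.eventually_ge_atTop ((i + j : ℕ) : ℝ)).exists
  have hn : ((i + j : ℕ) : ℤ) ≤ N (n • v) := by exact_mod_cast hn
  have h1 : latticeMap φ ((i + j) • t) x₀ ≤ latticeMap φ (n • v) x₀ := by
    rw [← natCast_zsmul]
    exact (hmono.monotone hn).trans (hN _)
  have h2 : latticeMap φ (n • v) x₀ < latticeMap φ (j • t) x := by
    calc _ < latticeMap φ (n • v) (latticeMap φ (j • t) x) := h.latticeMap_strictMono _ hj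
      _ = latticeMap φ (j • t) (latticeMap φ (n • v) x) := latticeMap_comm _ _ _
      _ ≤ _ := (h.latticeMap_strictMono _).monotone (latticeMap_nsmul_le h hle n)
  rw [add_comm, add_nsmul, latticeMap_add] at h1
  exact absurd (h1.trans_lt h2) (not_lt.mpr ((h.latticeMap_strictMono _).monotone hi.le))

/-- Two vectors with the same positive side, as seen by lattice points, are positively
proportional, since the lattice directions are dense. -/
theorem exists_pos_smul_eq {u u' : Fin 2 → ℝ} (hu : u ≠ 0) (hu' : u' ≠ 0)
    (h : ∀ v, 0 < cross u v → 0 ≤ cross u' v) : ∃ c > (0 : ℝ), u' = c • u := by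
  by_contra! hno
  obtain ⟨w, hw, hw'⟩ : ∃ w : Fin 2 → ℝ, 0 < u 0 * w 1 - u 1 * w 0 ∧
      u' 0 * w 1 - u' 1 * w 0 < 0 := by
    by_cases hD : u 0 * u' 1 - u 1 * u' 0 = 0
    · obtain ⟨c, hc⟩ := exists_smul_eq_of_det_eq_zero hu hD
      have hc0 : c ≠ 0 := by rintro rfl; exact hu' (by simpa using hc)
      have hcneg : c < 0 := by
        by_contra! hc'
        exact hno c (lt_of_le_of_ne hc' hc0.symm) hc
      have hpos : 0 < u 0 * u 0 + u 1 * u 1 := by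
        rcases fin_two_ne_zero hu with h0 | h0
        · nlinarith [mul_self_pos.mpr h0, mul_self_nonneg (u 1)]
        · nlinarith [mul_self_pos.mpr h0, mul_self_nonneg (u 0)]
      refine ⟨![-u 1, u 0], by simpa using hpos, ?_⟩
      rw [hc]
      simp only [Pi.smul_apply, smul_eq_mul, Matrix.cons_val_zero, Matrix.cons_val_one]
      nlinarith
    · set D := u 0 * u' 1 - u 1 * u' 0
      refine ⟨D • (u + u'), ?_, ?_⟩ <;>
        simp only [Pi.smul_apply, Pi.add_apply, smul_eq_mul]
      · rw [show u 0 * (D * (u 1 + u' 1)) - u 1 * (D * (u 0 + u' 0)) = D * D by ring]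
        exact mul_self_pos.mpr hD
      · rw [show u' 0 * (D * (u 1 + u' 1)) - u' 1 * (D * (u 0 + u' 0)) = -(D * D) by ring]
        exact neg_lt_zero.mpr (mul_self_pos.mpr hD)
  obtain ⟨n, hn⟩ := exists_nat_gt ((|u 0| + |u 1|) / (u 0 * w 1 - u 1 * w 0))
  obtain ⟨m, hm⟩ := exists_nat_gt ((|u' 0| + |u' 1|) / -(u' 0 * w 1 - u' 1 * w 0))
  rw [div_lt_iff₀ hw] at hn
  rw [div_lt_iff₀ (by linarith)] at hm
  -- Round a large multiple of `w`.
  set k : ℝ := ((n + m : ℕ) : ℝ) with hk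
  have hround : ∀ z : Fin 2 → ℝ, |cross z (fun i => ⌊k * w i⌋) - k * (z 0 * w 1 - z 1 * w 0)| ≤
      |z 0| + |z 1| := by
    intro z
    have hf : ∀ i, |Int.fract (k * w i)| ≤ 1 := fun i => by
      rw [abs_of_nonneg (Int.fract_nonneg _)]
      exact (Int.fract_lt_one _).le
    have : cross z (fun i => ⌊k * w i⌋) - k * (z 0 * w 1 - z 1 * w 0) =
        z 1 * Int.fract (k * w 0) - z 0 * Int.fract (k * w 1) := by
      simp only [cross, Int.fract]; ring
    rw [this]
    calc _ ≤ |z 1 * Int.fract (k * w 0)| + |z 0 * Int.fract (k * w 1)| := abs_sub _ _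
      _ ≤ |z 1| * 1 + |z 0| * 1 := by
        rw [abs_mul, abs_mul]
        gcongr <;> exact hf _
      _ = _ := by ring
  have h1 := abs_le.mp (hround u)
  have h2 := abs_le.mp (hround u')
  have hkn : (n : ℝ) ≤ k := by rw [hk]; push_cast; linarith [Nat.cast_nonneg (α := ℝ) m]
  have hkm : (m : ℝ) ≤ k := by rw [hk]; push_cast; linarith [Nat.cast_nonneg (α := ℝ) n]
  have h3 := mul_le_mul_of_nonneg_right hkn hw.le
  have h4 := mul_le_mul_of_nonneg_right hkm (show 0 ≤ -(u' 0 * w 1 - u' 1 * w 0) by linarith)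
  have := h (fun i => ⌊k * w i⌋) (by linarith)
  linarith

theorem IsDirection.exists_pos_smul (h : IsC1Action φ) {p q : ℝ} (hJ : IsComponent φ p q)
    {u u' : Fin 2 → ℝ} (hu : IsDirection φ p q u) (hu' : IsDirection φ p q u') :
    ∃ c > (0 : ℝ), u' = c • u := by
  refine exists_pos_smul_eq hu.1 hu'.1 fun v hv => ?_
  by_contra! hneg
  obtain ⟨x, hx⟩ := Set.nonempty_Ioo.mpr hJ.lt
  have h1 := hu'.2 (-v) (by rw [cross_neg]; linarith) _ (hJ.latticeMap_mem h v hx)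
  rw [latticeMap_neg_apply] at h1
  exact absurd (hu.2 v hv x hx) h1.not_gt

/-- The image of a component under `f` has the image direction. -/
theorem IsDirection.image (h : IsC1Action φ) {p q : ℝ} {u : Fin 2 → ℝ}
    (hu : IsDirection φ p q u) (f : F) :
    IsDirection φ (matrixMap φ f p) (matrixMap φ f q) (realAction f u) := by
  refine ⟨realAction_ne_zero _ hu.1, fun v hv x hx => ?_⟩
  have hx' : matrixMap φ f⁻¹ x ∈ Set.Ioo p q := by
    have h1 := h.matrixMap_strictMono f⁻¹ hx.1
    have h2 := h.matrixMap_strictMono f⁻¹ hx.2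
    rw [matrixMap_inv_apply] at h1 h2
    exact ⟨h1, h2⟩
  have hv' : 0 < cross u ((((f⁻¹ : F) : SL(2, ℤ)) : Matrix (Fin 2) (Fin 2) ℤ).mulVec v) := by
    rw [← cross_realAction f⁻¹, ← Module.End.mul_apply, ← map_mul] at hv
    simpa using hv
  have h1 := h.matrixMap_strictMono f (hu.2 _ hv' _ hx')
  rwa [matrixMap_latticeMap, matrixMap_apply_inv, Matrix.mulVec_mulVec,
    ← Matrix.SpecialLinearGroup.coe_mul, ← Subgroup.coe_mul, mul_inv_cancel, Subgroup.coe_one,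
    Matrix.SpecialLinearGroup.coe_one, Matrix.one_mulVec] at h1

end Directions

/-! ### The expanding walk -/

section Walk

variable {F : Subgroup SL(2, ℤ)} {φ : LinearSemidirect F →* Equiv.Perm ℝ}

theorem IsComponent.right_eq {p q q' : ℝ} (hJ : IsComponent φ p q) (hJ' : IsComponent φ p q') :
    q = q' :=
  le_antisymm (hJ.right_le_right hJ' le_rfl) (hJ'.right_le_right hJ le_rfl)

theorem IsComponent.left_eq {p p' q : ℝ} (hJ : IsComponent φ p q) (hJ' : IsComponent φ p' q) :
    p = p' := by
  rcases lt_trichotomy p p' with hlt | heq | hlt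
  · exact absurd (hJ.right_le_left hJ' hlt) (not_le.mpr hJ'.lt)
  · exact heq
  · exact absurd (hJ'.right_le_left hJ hlt) (not_le.mpr hJ.lt)

theorem matrixMap_zero (h : IsC1Action φ) (f : F) : matrixMap φ f 0 = 0 :=
  h.apply_eq_self _ 0 (by simp)

theorem matrixMap_one (h : IsC1Action φ) (f : F) : matrixMap φ f 1 = 1 :=
  h.apply_eq_self _ 1 (by simp)

/-- An infinite sequence of components in a compact subset of `]0, 1[`, each the image of the
preceding one under an element of a finite set which expands its direction. -/
structure IsExpandingWalk (φ : LinearSemidirect F →* Equiv.Perm ℝ) (S : Set F) (f : ℕ → F)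
    (p q : ℕ → ℝ) (u : ℕ → Fin 2 → ℝ) : Prop where
  finite : S.Finite
  mem : ∀ n, f n ∈ S
  isComponent : ∀ n, IsComponent φ (p n) (q n)
  isDirection : ∀ n, IsDirection φ (p n) (q n) (u n)
  left_succ : ∀ n, p (n + 1) = matrixMap φ (f n) (p n)
  right_succ : ∀ n, q (n + 1) = matrixMap φ (f n) (q n)
  direction_succ : ∀ n, u (n + 1) = realAction (f n) (u n)
  expanding : ∀ n, 8 * ‖u n‖ ≤ ‖u (n + 1)‖
  bounded : ∃ a > 0, ∃ b < 1, ∀ n, a ≤ p n ∧ q n ≤ b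
  injective : Function.Injective p

/-- Among the four powers of letters, at most one fails to expand a given direction, so that an
expanding one can be chosen which moves the component to the right if it lies to the left of the
initial one, and to the left otherwise. This keeps the walk in a compact set. It never visits a
component twice: the cone containing its direction reveals the last letter used, so that a
coincidence could be traced back to the initial component, whose direction lies in no cone. -/
theorem exists_isExpandingWalk (h : IsC1Action φ) {v₀ : Fin 2 → ℤ} (hv₀ : latticeMap φ v₀ ≠ 1)
    {a b : SL(2, ℤ)} (haF : a ∈ F) (hbF : b ∈ F) (ha : 3 ≤ |a 0 0 + a 1 1|)
    (hb : 3 ≤ |b 0 0 + b 1 1|) (hab : a * b ≠ b * a) :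
    ∃ S f p q u, IsExpandingWalk φ S f p q u := by
  obtain ⟨p', q', hJ', hp', hq'⟩ := exists_isComponent h hv₀
  obtain ⟨u', hu'⟩ := hJ'.exists_isDirection h
  obtain ⟨D, N, hdisj, hscale, hmap, g, hg, hgu⟩ := exists_expanding_cones ha hb hab hu'.1
  have hgF : g ∈ F := by
    refine (Subgroup.closure_le F).mpr ?_ hg
    rintro x (rfl | rfl) <;> assumption
  have hLF : ∀ s, letter a b s ^ N ∈ F := fun s => pow_mem (by
    rcases s with ⟨_ | _, _ | _⟩
    exacts [inv_mem hbF, hbF, inv_mem haF, haF]) N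
  let L : Bool × Bool → F := fun s => ⟨letter a b s ^ N, hLF s⟩
  have hLinv : ∀ s, L (invLetter s) = (L s)⁻¹ := fun s => by
    apply Subtype.ext
    change letter a b (invLetter s) ^ N = (letter a b s ^ N)⁻¹
    rw [letter_invLetter, inv_pow]
  let g' : F := ⟨g, hgF⟩
  set p₀ := matrixMap φ g' p'
  set q₀ := matrixMap φ g' q'
  set u₀ := realAction g u'
  have hJ₀ : IsComponent φ p₀ q₀ := hJ'.image h g'
  have hu₀ : IsDirection φ p₀ q₀ u₀ := hu'.image h g'
  -- No step fixes the initial component, as its direction would then lie in a cone. In particular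
  -- the component reaches neither `0` nor `1`.
  have hmove : ∀ s, matrixMap φ (L s) p₀ ≠ p₀ := by
    intro s hs
    have hJ := hJ₀.image h (L s)
    have hu := hu₀.image h (L s)
    rw [hs] at hJ hu
    rw [← hJ₀.right_eq hJ] at hu
    obtain ⟨c, hc, hcu⟩ := hu.exists_pos_smul h hJ₀ hu₀
    refine hgu s ?_
    rw [hcu]
    exact hscale _ _ c hc (hmap s u₀ hu₀.1 (hgu _)).1
  have hp₀ : 0 < p₀ := by
    refine lt_of_le_of_ne ?_ fun h0 => ?_
    · rw [← matrixMap_zero h g']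
      exact (h.matrixMap_strictMono g').monotone hp'
    · exact hmove (true, true) (by rw [← h0, matrixMap_zero h])
  have hq₀ : q₀ < 1 := by
    refine lt_of_le_of_ne ?_ fun h1 => ?_
    · rw [← matrixMap_one h g']
      exact (h.matrixMap_strictMono g').monotone hq'
    · refine hmove (true, true) ?_
      have hJ := hJ₀.image h (L (true, true))
      rw [h1, matrixMap_one h] at hJ
      exact hJ.left_eq (h1 ▸ hJ₀)
  have hright : ∀ (e : Bool) (x : ℝ), ∃ o, x ≤ matrixMap φ (L (e, o)) x := by
    intro e x
    rcases le_total x (matrixMap φ (L (e, true)) x) with hle | hle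
    · exact ⟨true, hle⟩
    · refine ⟨false, ?_⟩
      have := (h.matrixMap_strictMono (L (e, true))⁻¹).monotone hle
      rwa [matrixMap_inv_apply, ← hLinv] at this
  have hleft : ∀ (e : Bool) (x : ℝ), ∃ o, matrixMap φ (L (e, o)) x ≤ x := by
    intro e x
    rcases le_total (matrixMap φ (L (e, true)) x) x with hle | hle
    · exact ⟨true, hle⟩
    · refine ⟨false, ?_⟩
      have := (h.matrixMap_strictMono (L (e, true))⁻¹).monotone hle
      rwa [matrixMap_inv_apply, ← hLinv] at this
  -- At most one of a step with letter `a` and a step with letter `b` is excluded.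
  have hchoice : ∀ w : F, ∃ s, realAction w u₀ ∉ D (invLetter s) ∧
      ((matrixMap φ w p₀ ≤ p₀ ∧ matrixMap φ w p₀ ≤ matrixMap φ (L s) (matrixMap φ w p₀)) ∨
        (p₀ ≤ matrixMap φ w p₀ ∧ matrixMap φ (L s) (matrixMap φ w p₀) ≤ matrixMap φ w p₀)) := by
    intro w
    have hpair : ∀ o : Bool → Bool, ∃ e, realAction w u₀ ∉ D (invLetter (e, o e)) := by
      intro o
      by_contra! hno
      have := congrArg Prod.fst (hdisj _ _ _ (hno true) (hno false))
      simp [invLetter] at this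
    rcases le_total (matrixMap φ w p₀) p₀ with hle | hle
    · choose o ho using fun e => hright e (matrixMap φ w p₀)
      obtain ⟨e, he⟩ := hpair o
      exact ⟨(e, o e), he, Or.inl ⟨hle, ho e⟩⟩
    · choose o ho using fun e => hleft e (matrixMap φ w p₀)
      obtain ⟨e, he⟩ := hpair o
      exact ⟨(e, o e), he, Or.inr ⟨hle, ho e⟩⟩
  choose s hsD hsmove using hchoice
  obtain ⟨w, hw₀, hw⟩ : ∃ w : ℕ → F, w 0 = 1 ∧ ∀ n, w (n + 1) = L (s (w n)) * w n :=
    ⟨fun n => Nat.rec 1 (fun _ x => L (s x) * x) n, rfl, fun _ => rfl⟩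
  have hu0 : ∀ n, realAction (w n) u₀ ≠ 0 := fun n => realAction_ne_zero _ hu₀.1
  have hu_succ : ∀ n,
      realAction (w (n + 1)) u₀ = realAction (L (s (w n))) (realAction (w n : SL(2, ℤ)) u₀) :=
    fun n => by rw [hw, Subgroup.coe_mul, map_mul]; rfl
  have hp_succ : ∀ n x,
      matrixMap φ (w (n + 1)) x = matrixMap φ (L (s (w n))) (matrixMap φ (w n) x) :=
    fun n x => by rw [hw, matrixMap_mul]
  have hJ : ∀ n, IsComponent φ (matrixMap φ (w n) p₀) (matrixMap φ (w n) q₀) :=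
    fun n => hJ₀.image h (w n)
  have hu : ∀ n, IsDirection φ (matrixMap φ (w n) p₀) (matrixMap φ (w n) q₀)
    (realAction (w n) u₀) := fun n => hu₀.image h (w n)
  have hcone : ∀ n, realAction (w (n + 1)) u₀ ∈ D (s (w n)) ∧
      8 * ‖realAction (w n) u₀‖ ≤ ‖realAction (w (n + 1)) u₀‖ := fun n => by
    rw [hu_succ]
    exact hmap _ _ (hu0 n) (hsD (w n))
  obtain ⟨s₁, hs₁⟩ := Finite.exists_max fun s => matrixMap φ (L s) p₀
  obtain ⟨s₂, hs₂⟩ := Finite.exists_min fun s => matrixMap φ (L s) p₀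
  have hbound : ∀ n, matrixMap φ (L s₂) p₀ ≤ matrixMap φ (w n) p₀ ∧
      matrixMap φ (w n) p₀ ≤ matrixMap φ (L s₁) p₀ := by
    intro n
    induction n with
    | zero =>
      obtain ⟨o, ho⟩ := hright true p₀
      obtain ⟨o', ho'⟩ := hleft true p₀
      rw [hw₀, matrixMap_id]
      exact ⟨(hs₂ _).trans ho', ho.trans (hs₁ _)⟩
    | succ n ih =>
      rw [hp_succ]
      rcases hsmove (w n) with ⟨h1, h2⟩ | ⟨h1, h2⟩
      · exact ⟨ih.1.trans h2, ((h.matrixMap_strictMono _).monotone h1).trans (hs₁ _)⟩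
      · exact ⟨(hs₂ _).trans ((h.matrixMap_strictMono _).monotone h1), h2.trans ih.2⟩
  refine ⟨Set.range L, fun n => L (s (w n)), fun n => matrixMap φ (w n) p₀,
    fun n => matrixMap φ (w n) q₀, fun n => realAction (w n) u₀, Set.finite_range L,
    fun n => ⟨_, rfl⟩, hJ, hu, fun n => hp_succ n _, fun n => hp_succ n _, hu_succ,
    fun n => (hcone n).2, ⟨matrixMap φ (L s₂) p₀, ?_, matrixMap φ (L s₁) q₀, ?_, fun n =>
      ⟨(hbound n).1, (hJ n).right_le_right (hJ₀.image h (L s₁)) (hbound n).2⟩⟩, ?_⟩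
  · simpa [matrixMap_zero h] using h.matrixMap_strictMono (L s₂) hp₀
  · simpa [matrixMap_one h] using h.matrixMap_strictMono (L s₁) hq₀
  have hne : ∀ n m, n < m → matrixMap φ (w n) p₀ ≠ matrixMap φ (w m) p₀ := by
    intro n
    induction n with
    | zero =>
      intro m hm heq
      obtain ⟨m, rfl⟩ := Nat.exists_eq_succ_of_ne_zero hm.ne'
      have hJm := hJ (m + 1)
      have hum := hu (m + 1)
      rw [← heq] at hJm hum
      rw [← (hJ 0).right_eq hJm] at hum
      obtain ⟨c, hc, hcu⟩ := hum.exists_pos_smul h (hJ 0) (hu 0)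
      have hmem := hscale _ _ c hc (hcone m).1
      rw [← hcu, hw₀] at hmem
      exact hgu _ (by simpa using hmem)
    | succ n ih =>
      intro m hm heq
      obtain ⟨m, rfl⟩ := Nat.exists_eq_succ_of_ne_zero (by omega : m ≠ 0)
      have hJm := hJ (m + 1)
      have hum := hu (m + 1)
      rw [← heq] at hJm hum
      rw [← (hJ (n + 1)).right_eq hJm] at hum
      obtain ⟨c, hc, hcu⟩ := hum.exists_pos_smul h (hJ (n + 1)) (hu (n + 1))
      have hmem := hscale _ _ c hc (hcone m).1
      rw [← hcu] at hmem
      have hs := hdisj _ _ _ (hcone n).1 hmem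
      rw [hp_succ, hp_succ, hs] at heq
      exact ih m (by omega) ((matrixMap φ _).injective heq)
  intro n m heq
  rcases lt_trichotomy n m with hlt | heq' | hlt
  · exact absurd heq (hne n m hlt)
  · exact heq'
  · exact absurd heq.symm (hne m n hlt)

end Walk

/-! ### Displacements on short components -/

section Asymptotics

open Filter Topology Asymptotics

theorem IsC1Action.apply_mem {G : Type*} [Group G] {φ : G →* Equiv.Perm ℝ} (h : IsC1Action φ)
    (g : G) {x : ℝ} (hx : x ∈ Set.Ioo (0 : ℝ) 1) : φ g x ∈ Set.Ioo (0 : ℝ) 1 := by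
  have h0 := h.strictMono g hx.1
  have h1 := h.strictMono g hx.2
  rw [h.apply_eq_self g 0 (by simp)] at h0
  rw [h.apply_eq_self g 1 (by simp)] at h1
  exact ⟨h0, h1⟩

theorem IsC1Action.exists_deriv_mul {G : Type*} [Group G] {φ : G →* Equiv.Perm ℝ}
    (h : IsC1Action φ) (g : G) {y z : ℝ} (hy : 0 < y) (hz : z < 1) (hyz : y < z) :
    ∃ c ∈ Set.Ioo y z, φ g z - φ g y = deriv (φ g) c * (z - y) := by
  have hsub : Set.Ioo y z ⊆ Set.Ioo 0 1 := Set.Ioo_subset_Ioo hy.le hz.le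
  obtain ⟨c, hc, hc'⟩ := exists_deriv_eq_slope (φ g) hyz (h.continuous g).continuousOn
    ((h.contDiffOn g).differentiableOn one_ne_zero |>.mono hsub)
  refine ⟨c, hc, ?_⟩
  rw [hc', div_mul_cancel₀ _ (sub_pos.mpr hyz).ne']

/-- On short intervals inside a compact subset of `]0, 1[`, a `C¹` map is uniformly close to an
affine one. -/
theorem IsC1Action.exists_distortion {G : Type*} [Group G] {φ : G →* Equiv.Perm ℝ}
    (h : IsC1Action φ) (g : G) {a b : ℝ} (ha : 0 < a) (hb : b < 1) {ε : ℝ} (hε : 0 < ε) :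
    ∃ δ > 0, ∀ p q, a ≤ p → p < q → q ≤ b → q - p < δ → ∀ y ∈ Set.Icc p q, ∀ z ∈ Set.Icc p q,
      |φ g z - φ g y - (φ g q - φ g p) / (q - p) * (z - y)| ≤ ε * |z - y| := by
  have hsub : Set.Icc a b ⊆ Set.Ioo 0 1 := fun x hx => ⟨ha.trans_le hx.1, hx.2.trans_lt hb⟩
  have hcont : ContinuousOn (deriv (φ g)) (Set.Icc a b) :=
    ((h.contDiffOn g).continuousOn_deriv_of_isOpen isOpen_Ioo le_rfl).mono hsub
  obtain ⟨δ, hδ, hδε⟩ := Metric.uniformContinuousOn_iff.mp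
    (isCompact_Icc.uniformContinuousOn_of_continuous hcont) ε hε
  refine ⟨δ, hδ, fun p q hap hpq hqb hlt => ?_⟩
  obtain ⟨c, hc, hslope⟩ := h.exists_deriv_mul g (ha.trans_le hap) (hqb.trans_lt hb) hpq
  have hslope : (φ g q - φ g p) / (q - p) = deriv (φ g) c := by
    rw [hslope, mul_div_cancel_right₀ _ (sub_pos.mpr hpq).ne']
  rw [hslope]
  have key : ∀ y ∈ Set.Icc p q, ∀ z ∈ Set.Icc p q, y < z →
      |φ g z - φ g y - deriv (φ g) c * (z - y)| ≤ ε * |z - y| := by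
    intro y hy z hz hyz
    obtain ⟨e, he, hyze⟩ := h.exists_deriv_mul g (ha.trans_le (hap.trans hy.1))
      ((hz.2.trans hqb).trans_lt hb) hyz
    rw [hyze, ← sub_mul, abs_mul]
    gcongr
    refine (hδε e ⟨?_, ?_⟩ c ⟨?_, ?_⟩ ?_).le
    · linarith [hy.1, he.1]
    · linarith [hz.2, he.2]
    · linarith [hc.1]
    · linarith [hc.2]
    · rw [Real.dist_eq, abs_lt]
      constructor <;> linarith [hy.1, hz.2, he.1, he.2, hc.1, hc.2]
  intro y hy z hz
  rcases lt_trichotomy y z with hlt' | rfl | hlt'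
  · exact key y hy z hz hlt'
  · simp
  · have := key z hz y hy hlt'
    rw [abs_sub_comm z y, ← abs_neg]
    refine le_trans (le_of_eq ?_) this
    congr 1; ring

/-- The inverse of a `C¹` diffeomorphism is Lipschitz on compact sets. -/
theorem IsC1Action.exists_slope_lower_bound {G : Type*} [Group G] {φ : G →* Equiv.Perm ℝ}
    (h : IsC1Action φ) (g : G) {a b : ℝ} (ha : 0 < a) (hb : b < 1) :
    ∃ m > 0, ∀ p q, a ≤ p → p < q → q ≤ b → m * (q - p) ≤ φ g q - φ g p := by
  by_cases hab : a < b
  swap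
  · exact ⟨1, one_pos, fun p q hp hpq hq => absurd (hp.trans_lt (hpq.trans_le hq)) hab⟩
  have ha' := h.apply_mem g ⟨ha, hab.trans hb⟩
  have hb' := h.apply_mem g ⟨ha.trans hab, hb⟩
  have hsub : Set.Icc (φ g a) (φ g b) ⊆ Set.Ioo 0 1 :=
    fun x hx => ⟨ha'.1.trans_le hx.1, hx.2.trans_lt hb'.2⟩
  obtain ⟨C, hC⟩ := isCompact_Icc.exists_bound_of_continuousOn
    (((h.contDiffOn g⁻¹).continuousOn_deriv_of_isOpen isOpen_Ioo le_rfl).mono hsub)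
  have hC1 : 0 < |C| + 1 := by positivity
  refine ⟨(|C| + 1)⁻¹, by positivity, fun p q hp hpq hq => ?_⟩
  rw [inv_mul_le_iff₀ hC1]
  have hp' : φ g a ≤ φ g p := (h.strictMono g).monotone hp
  have hq' : φ g q ≤ φ g b := (h.strictMono g).monotone hq
  have hpq' := h.strictMono g hpq
  obtain ⟨c, hc, hslope⟩ := h.exists_deriv_mul g⁻¹ (ha'.1.trans_le hp') (hq'.trans_lt hb'.2) hpq'
  have hinv : ∀ x, φ g⁻¹ (φ g x) = x := fun x => by simp
  rw [hinv, hinv] at hslope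
  rw [hslope]
  have hCc := hC c ⟨hp'.trans hc.1.le, hc.2.le.trans hq'⟩
  rw [Real.norm_eq_abs] at hCc
  have : 0 ≤ φ g q - φ g p := by linarith
  gcongr
  linarith [le_abs_self (deriv (φ g⁻¹) c), le_abs_self C]

/-- If the half-planes of unit vectors `U n` and `V n` agree asymptotically, as seen by lattice
points, then `U n - V n` tends to `0`: this holds for limits along subsequences. -/
theorem tendsto_sub_of_cross {U V : ℕ → Fin 2 → ℝ} (hU : ∀ n, ‖U n‖ = 1) (hV : ∀ n, ‖V n‖ = 1)
    (h : ∀ v, ∃ e : ℕ → ℝ, Tendsto e atTop (𝓝 0) ∧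
      ∀ n, 0 < cross (U n) v → e n ≤ cross (V n) v) :
    Tendsto (fun n => U n - V n) atTop (𝓝 0) := by
  have hcont : ∀ v, Continuous fun u : Fin 2 → ℝ => cross u v := fun v => by
    unfold cross; fun_prop
  refine tendsto_of_subseq_tendsto fun ns hns => ?_
  have hK : IsCompact (Metric.sphere (0 : Fin 2 → ℝ) 1 ×ˢ Metric.sphere (0 : Fin 2 → ℝ) 1) :=
    (isCompact_sphere 0 1).prod (isCompact_sphere 0 1)
  obtain ⟨⟨u, d⟩, ⟨hu, hd⟩, ms, hms, hlim⟩ := hK.tendsto_subseq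
    (x := fun n => (U (ns n), V (ns n))) fun n => ⟨by simp [hU], by simp [hV]⟩
  rw [mem_sphere_zero_iff_norm] at hu hd
  simp only at hu hd
  have hu0 : u ≠ 0 := by rintro rfl; simp at hu
  have hd0 : d ≠ 0 := by rintro rfl; simp at hd
  have hUlim : Tendsto (fun n => U (ns (ms n))) atTop (𝓝 u) :=
    (continuous_fst.tendsto _).comp hlim
  have hVlim : Tendsto (fun n => V (ns (ms n))) atTop (𝓝 d) :=
    (continuous_snd.tendsto _).comp hlim
  obtain ⟨c, hc, hdc⟩ := exists_pos_smul_eq hu0 hd0 fun v hv => by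
    obtain ⟨e, he, heV⟩ := h v
    refine le_of_tendsto_of_tendsto (he.comp (hns.comp hms.tendsto_atTop))
      (((hcont v).tendsto d).comp hVlim) ?_
    filter_upwards [(Tendsto.comp ((hcont v).tendsto u) hUlim).eventually_const_lt hv] with n hn
    exact heV _ hn
  have hc1 : c = 1 := by
    rw [hdc, norm_smul, hu, mul_one, Real.norm_eq_abs, abs_of_pos hc] at hd
    exact hd
  refine ⟨ms, ?_⟩
  have := hUlim.sub hVlim
  rwa [hdc, hc1, one_smul, sub_self] at this

theorem cross_single_le (w : Fin 2 → ℝ) (i : Fin 2) : |cross w (Pi.single i 1)| ≤ ‖w‖ := by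
  have := fun j => norm_le_pi_norm w j
  simp only [Real.norm_eq_abs] at this
  fin_cases i <;> simp [cross, this]

theorem norm_le_of_cross {w : Fin 2 → ℝ} {C : ℝ} (hC : 0 ≤ C)
    (h : ∀ i, |cross w (Pi.single i 1)| ≤ C) : ‖w‖ ≤ C := by
  rw [pi_norm_le_iff_of_nonneg hC]
  have h0 := h 0
  have h1 := h 1
  simp [cross] at h0 h1
  exact Fin.forall_fin_two.mpr ⟨h1, h0⟩

variable {F : Subgroup SL(2, ℤ)} {φ : LinearSemidirect F →* Equiv.Perm ℝ}

/-- The displacements of a point under the two generators of `ℤ²`, arranged so that the area form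
pairs this vector with each basis vector to the corresponding displacement. -/
def displacement (φ : LinearSemidirect F →* Equiv.Perm ℝ) (x : ℝ) : Fin 2 → ℝ :=
  ![latticeMap φ (Pi.single 1 1) x - x, -(latticeMap φ (Pi.single 0 1) x - x)]

theorem cross_displacement (x : ℝ) (i : Fin 2) :
    cross (displacement φ x) (Pi.single i 1) = latticeMap φ (Pi.single i 1) x - x := by
  fin_cases i <;> simp [cross, displacement]

theorem abs_cross_le (u : Fin 2 → ℝ) (v : Fin 2 → ℤ) :
    |cross u v| ≤ (|(v 1 : ℝ)| + |(v 0 : ℝ)|) * ‖u‖ := by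
  have := fun j => norm_le_pi_norm u j
  simp only [Real.norm_eq_abs] at this
  calc |cross u v| ≤ |u 0 * v 1| + |u 1 * v 0| := abs_sub _ _
    _ ≤ ‖u‖ * |(v 1 : ℝ)| + ‖u‖ * |(v 0 : ℝ)| := by
      rw [abs_mul, abs_mul]
      gcongr <;> exact this _
    _ = _ := by ring

/-- The components are disjoint intervals in a bounded set. -/
theorem tendsto_length {p q : ℕ → ℝ} (hJ : ∀ n, IsComponent φ (p n) (q n))
    (hp : Function.Injective p) {a b : ℝ} (hab : ∀ n, a ≤ p n ∧ q n ≤ b) :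
    Tendsto (fun n => q n - p n) atTop (𝓝 0) := by
  have hdisj : Pairwise (Function.onFun Disjoint fun n => Set.Ioo (p n) (q n)) := by
    intro n m hnm
    rcases lt_or_gt_of_ne (hp.ne hnm) with hlt | hlt
    · have := (hJ n).right_le_left (hJ m) hlt
      exact Set.disjoint_left.mpr fun x hx hx' => by linarith [hx.2, hx'.1]
    · have := (hJ m).right_le_left (hJ n) hlt
      exact Set.disjoint_left.mpr fun x hx hx' => by linarith [hx.1, hx'.2]
  have hsum : ∑' n, MeasureTheory.volume (Set.Ioo (p n) (q n)) ≠ ⊤ := by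
    rw [← MeasureTheory.measure_iUnion hdisj fun _ => measurableSet_Ioo]
    refine ((MeasureTheory.measure_mono (Set.iUnion_subset fun n => ?_)).trans_lt
      (measure_Icc_lt_top (a := a) (b := b))).ne
    exact fun x hx => ⟨(hab n).1.trans hx.1.le, hx.2.le.trans (hab n).2⟩
  refine (ENNReal.summable_toReal hsum).tendsto_atTop_zero.congr fun n => ?_
  rw [Real.volume_Ioo, ENNReal.toReal_ofReal (sub_nonneg.mpr (hJ n).lt.le)]

/-- On short components `ℤ²` acts almost by translations, because its elements fix both end points
and hence have derivative close to `1`. -/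
theorem isLittleO_latticeMap (h : IsC1Action φ) {p q : ℕ → ℝ}
    (hJ : ∀ n, IsComponent φ (p n) (q n)) {a b : ℝ} (ha : 0 < a) (hb : b < 1)
    (hab : ∀ n, a ≤ p n ∧ q n ≤ b) (hlen : Tendsto (fun n => q n - p n) atTop (𝓝 0))
    (v : Fin 2 → ℤ) {y z : ℕ → ℝ} (hy : ∀ n, y n ∈ Set.Ioo (p n) (q n))
    (hz : ∀ n, z n ∈ Set.Ioo (p n) (q n)) :
    (fun n => latticeMap φ v (z n) - latticeMap φ v (y n) - (z n - y n))
      =o[atTop] fun n => z n - y n := by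
  refine isLittleO_iff.mpr fun ε hε => ?_
  obtain ⟨δ, hδ, hdist⟩ := h.exists_distortion (SemidirectProduct.inl (.ofAdd v)) ha hb hε
  filter_upwards [hlen.eventually_lt_const hδ] with n hn
  have := hdist _ _ (hab n).1 (hJ n).lt (hab n).2 hn (y n) (Set.Ioo_subset_Icc_self (hy n)) (z n)
    (Set.Ioo_subset_Icc_self (hz n))
  change |latticeMap φ v _ - latticeMap φ v _ - (latticeMap φ v _ - latticeMap φ v _) / _ * _| ≤ _
    at this
  rwa [(hJ n).left, (hJ n).right, div_self (sub_pos.mpr (hJ n).lt).ne', one_mul] at this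

/-- On short components, the displacement under `v` is asymptotically linear in `v`. -/
theorem isLittleO_displacement (h : IsC1Action φ) {p q : ℕ → ℝ}
    (hJ : ∀ n, IsComponent φ (p n) (q n)) {a b : ℝ} (ha : 0 < a) (hb : b < 1)
    (hab : ∀ n, a ≤ p n ∧ q n ≤ b) (hlen : Tendsto (fun n => q n - p n) atTop (𝓝 0))
    {x : ℕ → ℝ} (hx : ∀ n, x n ∈ Set.Ioo (p n) (q n)) (v : Fin 2 → ℤ) :
    (fun n => latticeMap φ v (x n) - x n - cross (displacement φ (x n)) v)
      =o[atTop] fun n => ‖displacement φ (x n)‖ := by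
  let P : (Fin 2 → ℤ) → Prop := fun v =>
    (fun n => latticeMap φ v (x n) - x n - cross (displacement φ (x n)) v)
      =o[atTop] fun n => ‖displacement φ (x n)‖
  have hO : ∀ v, P v → (fun n => latticeMap φ v (x n) - x n)
      =O[atTop] fun n => ‖displacement φ (x n)‖ := by
    intro v hv
    have h1 : (fun n => cross (displacement φ (x n)) v)
        =O[atTop] fun n => ‖displacement φ (x n)‖ :=
      IsBigO.of_bound _ (Eventually.of_forall fun n => by
        rw [norm_norm]; exact abs_cross_le _ _)
    refine (hv.isBigO.add h1).congr_left fun n => ?_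
    ring
  have hmem : ∀ v n, latticeMap φ v (x n) ∈ Set.Ioo (p n) (q n) := fun v n =>
    (hJ n).latticeMap_mem h v (hx n)
  have hadd : ∀ v w, P v → P w → P (v + w) := by
    intro v w hv hw
    have h1 := (isLittleO_latticeMap h hJ ha hb hab hlen v hx (hmem w)).trans_isBigO (hO w hw)
    refine ((h1.add hv).add hw).congr_left fun n => ?_
    rw [latticeMap_add, cross_add]
    ring
  have hneg : ∀ v, P v → P (-v) := by
    intro v hv
    have h1 := (isLittleO_latticeMap h hJ ha hb hab hlen (-v) hx (hmem v)).trans_isBigO (hO v hv)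
    refine (h1.add hv).neg_left.congr_left fun n => ?_
    rw [latticeMap_neg_apply, cross_neg]
    ring
  have hzero : P 0 := by
    refine (isLittleO_zero _ _).congr_left fun n => ?_
    rw [latticeMap_zero]
    simp [cross]
  refine mem_of_basis_mem
    { carrier := {v | P v}
      add_mem' := fun {v w} => hadd v w
      zero_mem' := hzero
      neg_mem' := fun {v} => hneg v } (fun i => ?_) v
  refine (isLittleO_zero _ _).congr_left fun n => ?_
  rw [cross_displacement, sub_self]

theorem displacement_ne_zero {p q : ℝ} (hJ : IsComponent φ p q) {x : ℝ} (hx : x ∈ Set.Ioo p q) :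
    displacement φ x ≠ 0 := by
  intro h0
  obtain ⟨v, hv⟩ := hJ.exists_ne x hx
  refine hv (latticeMap_eq_self_of_basis (fun i => ?_) v)
  have := cross_displacement (φ := φ) x i
  rw [h0] at this
  simp only [cross, Pi.zero_apply, zero_mul, sub_self] at this
  linarith

theorem norm_displacement_le (h : IsC1Action φ) {p q : ℝ} (hJ : IsComponent φ p q) {x : ℝ}
    (hx : x ∈ Set.Ioo p q) : ‖displacement φ x‖ ≤ q - p := by
  refine norm_le_of_cross (sub_nonneg.mpr hJ.lt.le) fun i => ?_
  rw [cross_displacement, abs_le]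
  have := hJ.latticeMap_mem h (Pi.single i 1) hx
  constructor <;> linarith [this.1, this.2, hx.1, hx.2]

end Asymptotics

/-! ### Growth of the displacement -/

section Contradiction

open Filter Topology Asymptotics

variable {F : Subgroup SL(2, ℤ)} {φ : LinearSemidirect F →* Equiv.Perm ℝ}

/-- Along a sequence of components of lengths tending to zero, the displacement vectors point
asymptotically in the directions of the components. -/
theorem tendsto_direction_sub_displacement (h : IsC1Action φ) {p q : ℕ → ℝ} {u : ℕ → Fin 2 → ℝ}
    (hJ : ∀ n, IsComponent φ (p n) (q n)) (hu : ∀ n, IsDirection φ (p n) (q n) (u n)) {a b : ℝ}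
    (ha : 0 < a) (hb : b < 1) (hab : ∀ n, a ≤ p n ∧ q n ≤ b)
    (hlen : Tendsto (fun n => q n - p n) atTop (𝓝 0))
    {x : ℕ → ℝ} (hx : ∀ n, x n ∈ Set.Ioo (p n) (q n)) :
    Tendsto (fun n => ‖u n‖⁻¹ • u n - ‖displacement φ (x n)‖⁻¹ • displacement φ (x n))
      atTop (𝓝 0) := by
  have hd : ∀ n, 0 < ‖displacement φ (x n)‖ := fun n =>
    norm_pos_iff.mpr (displacement_ne_zero (hJ n) (hx n))
  have hu0 : ∀ n, 0 < ‖u n‖ := fun n => norm_pos_iff.mpr (hu n).1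
  refine tendsto_sub_of_cross (fun n => ?_) (fun n => ?_) fun v => ?_
  · rw [norm_smul, norm_inv, norm_norm, inv_mul_cancel₀ (hu0 n).ne']
  · rw [norm_smul, norm_inv, norm_norm, inv_mul_cancel₀ (hd n).ne']
  have ho := (isLittleO_displacement h hJ ha hb hab hlen hx v).tendsto_div_nhds_zero.neg
  rw [neg_zero] at ho
  refine ⟨_, ho, fun n hn => ?_⟩
  rw [cross_smul] at hn ⊢
  have hpos := (hu n).2 v (pos_of_mul_pos_right hn (inv_nonneg.mpr (hu0 n).le)) (x n) (hx n)
  rw [← neg_div, ← div_eq_inv_mul]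
  exact div_le_div_of_nonneg_right (by linarith) (hd n).le

/-- Along an expanding walk the ratio of displacement and length would at least double with each
step, whereas it never exceeds `1`. -/
theorem IsExpandingWalk.elim (h : IsC1Action φ) {S : Set F} {f : ℕ → F} {p q : ℕ → ℝ}
    {u : ℕ → Fin 2 → ℝ} (hW : IsExpandingWalk φ S f p q u) : False := by
  obtain ⟨a, ha, b, hb, hab⟩ := hW.bounded
  have hJ := hW.isComponent
  have hlen := tendsto_length hJ hW.injective hab
  obtain ⟨x₀, hx₀⟩ := Set.nonempty_Ioo.mpr (hJ 0).lt
  obtain ⟨x, hx0, hxs⟩ : ∃ x : ℕ → ℝ, x 0 = x₀ ∧ ∀ n, x (n + 1) = matrixMap φ (f n) (x n) :=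
    ⟨fun n => Nat.rec x₀ (fun n y => matrixMap φ (f n) y) n, rfl, fun _ => rfl⟩
  have hx : ∀ n, x n ∈ Set.Ioo (p n) (q n) := by
    intro n
    induction n with
    | zero => rwa [hx0]
    | succ n ih =>
      rw [hxs, hW.left_succ, hW.right_succ]
      exact ⟨h.matrixMap_strictMono _ ih.1, h.matrixMap_strictMono _ ih.2⟩
  set d : ℕ → Fin 2 → ℝ := fun n => displacement φ (x n) with hd
  have hd0 : ∀ n, 0 < ‖d n‖ := fun n => norm_pos_iff.mpr (displacement_ne_zero (hJ n) (hx n))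
  have hl0 : ∀ n, 0 < q n - p n := fun n => sub_pos.mpr (hJ n).lt
  have hu0 : ∀ n, 0 < ‖u n‖ := fun n => norm_pos_iff.mpr (hW.isDirection n).1
  have hdir := tendsto_direction_sub_displacement h hJ hW.isDirection ha hb hab hlen hx
  have hstep : ∀ g ∈ S, ∀ᶠ n in atTop, f n = g →
      2 * (‖d n‖ / (q n - p n)) ≤ ‖d (n + 1)‖ / (q (n + 1) - p (n + 1)) := by
    intro g _
    obtain ⟨m, hm, hslope⟩ := h.exists_slope_lower_bound (SemidirectProduct.inr g) ha hb
    obtain ⟨δ, hδ, hdist⟩ := h.exists_distortion (SemidirectProduct.inr g) ha hb (half_pos hm)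
    -- The lattice vectors which `g` maps to the basis vectors.
    let v : Fin 2 → Fin 2 → ℤ := fun i =>
      (((g⁻¹ : F) : SL(2, ℤ)) : Matrix (Fin 2) (Fin 2) ℤ).mulVec (Pi.single i 1)
    have hgv : ∀ i, ((g : SL(2, ℤ)) : Matrix (Fin 2) (Fin 2) ℤ).mulVec (v i) = Pi.single i 1 := by
      intro i
      rw [Matrix.mulVec_mulVec, ← Matrix.SpecialLinearGroup.coe_mul, ← Subgroup.coe_mul,
        mul_inv_cancel, Subgroup.coe_one, Matrix.SpecialLinearGroup.coe_one, Matrix.one_mulVec]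
    have hlin : ∀ᶠ n in atTop, ∀ i,
        |latticeMap φ (v i) (x n) - x n - cross (d n) (v i)| ≤ ‖d n‖ := by
      refine eventually_all.mpr fun i => ?_
      filter_upwards [(isLittleO_displacement h hJ ha hb hab hlen hx (v i)).bound one_pos] with n hn
      rwa [norm_norm, one_mul] at hn
    have hcont : Continuous (realAction g) := LinearMap.continuous_of_finiteDimensional _
    have hsmall := ((hcont.tendsto 0).comp hdir).norm
    rw [map_zero, norm_zero] at hsmall
    filter_upwards [hlin, hlen.eventually_lt_const hδ, hsmall.eventually_lt_const one_pos]
      with n hn1 hn2 hn3 hfn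
    have hkm : m ≤ (matrixMap φ g (q n) - matrixMap φ g (p n)) / (q n - p n) := by
      rw [le_div_iff₀ (hl0 n)]
      exact hslope _ _ (hab n).1 (hJ n).lt (hab n).2
    set k := (matrixMap φ g (q n) - matrixMap φ g (p n)) / (q n - p n) with hk
    have hk0 : 0 < k := hm.trans_le hkm
    have hlen_succ : q (n + 1) - p (n + 1) = k * (q n - p n) := by
      rw [hW.left_succ, hW.right_succ, hfn, hk, div_mul_cancel₀ _ (hl0 n).ne']
    -- The map expands distances in the component at least by half of its average slope.
    have hexp : ∀ z ∈ Set.Ioo (p n) (q n),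
        k / 2 * |z - x n| ≤ |matrixMap φ g z - matrixMap φ g (x n)| := by
      intro z hz
      have h1 : |matrixMap φ g z - matrixMap φ g (x n) - k * (z - x n)| ≤ m / 2 * |z - x n| :=
        hdist _ _ (hab n).1 (hJ n).lt (hab n).2 hn2 (x n) (Set.Ioo_subset_Icc_self (hx n)) z
          (Set.Ioo_subset_Icc_self hz)
      have h2 := abs_sub_abs_le_abs_sub (k * (z - x n)) (matrixMap φ g z - matrixMap φ g (x n))
      rw [abs_sub_comm (k * (z - x n)), abs_mul, abs_of_pos hk0] at h2
      have h3 := mul_le_mul_of_nonneg_right hkm (abs_nonneg (z - x n))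
      linarith
    have hupper : ‖realAction g (d n)‖ ≤ 2 / k * ‖d (n + 1)‖ + ‖d n‖ := by
      refine norm_le_of_cross (by positivity) fun i => ?_
      rw [← hgv i, cross_realAction]
      have h1 := hexp _ ((hJ n).latticeMap_mem h (v i) (hx n))
      rw [matrixMap_latticeMap, hgv, ← hfn, ← hxs, ← cross_displacement] at h1
      have h2 := h1.trans (cross_single_le _ i)
      have h3 := abs_sub_abs_le_abs_sub (cross (d n) (v i)) (latticeMap φ (v i) (x n) - x n)
      rw [abs_sub_comm (cross (d n) (v i))] at h3
      have h4 : |latticeMap φ (v i) (x n) - x n| ≤ 2 / k * ‖d (n + 1)‖ := by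
        rw [div_mul_eq_mul_div, le_div_iff₀ hk0]
        linarith
      linarith [hn1 i]
    have hlower : 7 * ‖d n‖ ≤ ‖realAction g (d n)‖ := by
      have h1 : 8 ≤ ‖realAction g (‖u n‖⁻¹ • u n)‖ := by
        rw [map_smul, norm_smul, norm_inv, norm_norm, ← hfn, ← hW.direction_succ,
          ← div_eq_inv_mul, le_div_iff₀ (hu0 n)]
        exact hW.expanding n
      have h2 : 7 ≤ ‖realAction g (‖d n‖⁻¹ • d n)‖ := by
        have h3 := norm_sub_norm_le (realAction g (‖u n‖⁻¹ • u n))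
          (realAction g (‖d n‖⁻¹ • d n))
        rw [← map_sub] at h3
        have h4 : ‖realAction g (‖u n‖⁻¹ • u n - ‖d n‖⁻¹ • d n)‖ < 1 := hn3
        linarith
      rwa [map_smul, norm_smul, norm_inv, norm_norm, ← div_eq_inv_mul, le_div_iff₀ (hd0 n)] at h2
    have hfinal : 3 * k * ‖d n‖ ≤ ‖d (n + 1)‖ := by
      have h1 : 6 * ‖d n‖ ≤ 2 / k * ‖d (n + 1)‖ := by linarith
      rw [div_mul_eq_mul_div, le_div_iff₀ hk0] at h1
      linarith
    rw [hlen_succ, mul_div_assoc', div_le_div_iff₀ (hl0 n) (mul_pos hk0 (hl0 n))]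
    have h1 := mul_le_mul_of_nonneg_right hfinal (hl0 n).le
    have h2 : 0 ≤ k * ‖d n‖ * (q n - p n) := by have := hl0 n; positivity
    linarith
  have hgrow := (eventually_all_finite hW.finite).mpr hstep
  obtain ⟨n₀, hn₀⟩ := eventually_atTop.mp hgrow
  have hpow : ∀ k : ℕ, 2 ^ k * (‖d n₀‖ / (q n₀ - p n₀)) ≤
      ‖d (n₀ + k)‖ / (q (n₀ + k) - p (n₀ + k)) := by
    intro k
    induction k with
    | zero => simp
    | succ k ih =>
      have := hn₀ (n₀ + k) (by omega) _ (hW.mem _) rfl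
      rw [pow_succ', mul_assoc]
      refine le_trans ?_ this
      gcongr
  obtain ⟨k, hk⟩ := pow_unbounded_of_one_lt (‖d n₀‖ / (q n₀ - p n₀))⁻¹ one_lt_two
  have hr : 0 < ‖d n₀‖ / (q n₀ - p n₀) := div_pos (hd0 n₀) (hl0 n₀)
  rw [inv_lt_iff_one_lt_mul₀ hr] at hk
  have hle : ‖d (n₀ + k)‖ / (q (n₀ + k) - p (n₀ + k)) ≤ 1 :=
    (div_le_one (hl0 _)).mpr (norm_displacement_le h (hJ _) (hx _))
  linarith [hpow k]

/-- A free group of rank at least two of integral matrices, extended by `ℤ²`, has no `C¹` action on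
`]0, 1[` that is faithful on `ℤ²`. -/
theorem not_injective_of_isC1Action {ι : Type*} [Nontrivial ι] (B : FreeGroupBasis ι F)
    (h : IsC1Action φ) : ¬ Function.Injective φ := by
  intro hφ
  obtain ⟨a, haF, b, hbF, ha, hb, hab⟩ := exists_hyperbolic_pair B
  have hne : latticeMap φ (Pi.single 0 1) ≠ 1 := by
    intro h1
    rw [latticeMap, ← map_one φ] at h1
    have h2 := congrArg (fun z => z.left.toAdd 0) (hφ h1)
    simp at h2
  obtain ⟨S, f, p, q, u, hW⟩ := exists_isExpandingWalk h hne haF hbF ha hb hab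
  exact hW.elim h

end Contradiction

/-! ### Non-embedding -/

theorem not_embedsInDiffPlus {F : Subgroup SL(2, ℤ)} {ι : Type*} [Nontrivial ι]
    (B : FreeGroupBasis ι F) {I : Set ℝ} [I.OrdConnected] (hI : Set.Ioo 0 1 ⊆ I)
    (hI' : I ⊆ Set.Icc 0 1) : ¬ EmbedsInDiffPlus (LinearSemidirect F) I := fun h => by
  obtain ⟨φ, hφ, hC1⟩ := h.exists_isC1Action hI hI'
  exact not_injective_of_isC1Action B hC1 hφ

theorem theoremA :
    (∀ (F : Subgroup SL(2, ℤ)) (ι : Type*) [Nontrivial ι], Nonempty (FreeGroupBasis ι F) →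
      LocallyIndicable (LinearSemidirect F) ∧
        ¬ EmbedsInDiffPlus (LinearSemidirect F) (Set.Ioo (0 : ℝ) 1)) ∧
    (∃ (G : Type) (_ : Group G), Group.FG G ∧ LocallyIndicable G ∧
      ¬ EmbedsInDiffPlus G (Set.Ioo (0 : ℝ) 1) ∧
      ¬ EmbedsInDiffPlus G (Set.Ico (0 : ℝ) 1) ∧
      ¬ EmbedsInDiffPlus G (Set.Icc (0 : ℝ) 1)) := by
  refine ⟨fun F ι _ ⟨B⟩ => ?_, ?_⟩
  · have := B.isFreeGroup
    exact ⟨locallyIndicable_linearSemidirect F,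
      not_embedsInDiffPlus B subset_rfl Set.Ioo_subset_Icc_self⟩
  · obtain ⟨F, hF, ⟨B⟩⟩ := exists_free_subgroup_rank_two
    have := B.isFreeGroup
    exact ⟨LinearSemidirect F, inferInstance, fg_linearSemidirect F,
      locallyIndicable_linearSemidirect F,
      not_embedsInDiffPlus B subset_rfl Set.Ioo_subset_Icc_self,
      not_embedsInDiffPlus B Set.Ioo_subset_Ico_self Set.Ico_subset_Icc_self,
      not_embedsInDiffPlus B Set.Ioo_subset_Icc_self subset_rfl⟩
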